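/- **Setting.** An anonymous quantum network is a connected undirected simple graph on $n\ge 1$ parties together with an arbitrary port numbering (each party $v$ of degree $d_v$ labels its incident links bijectively by $1,\dots,d_v$). Each party $v$ holds a one-qubit input register, a one-qubit output register, a finite-dimensional work memory, and one message register per port. Besides the number of its ports, a party is given only an integer $N$ with $N\ge n$; it knows neither $n$ nor the topology nor any identifier. All parties run the same algorithm without intermediate measurements: for a number of synchronous rounds that depends only on $N$, every party alternately applies a unitary to its own registers, depending only on $N$, on its number of ports and on the round, and exchanges messages (binary words, possibly in superposition, the empty word meaning that nothing is sent) with all its neighbours; a last local unitary follows the last round. For $f:\{0,1\}^n\to\{\mathrm{true},\mathrm{false}\}$, an $f$-algorithm on a network $G$ given $N$ is an algorithm that, for all amplitudes with $\sum_x|\alpha_x|^2=1$, transforms $\sum_{x}\alpha_{x}\bigotimes_{v}(|x_v\rangle|\mathrm{true}\rangle)$, with all memories in a fixed initial state and all message registers empty, exactly into $\sum_{x}\alpha_{x}\bigotimes_{v}(|x_v\rangle|f(x)\rangle)\otimes|g_x\rangle$, where $|g_x\rangle$ is a (garbage) state of the memories and message registers; it is garbage-free if every $|g_x\rangle$ is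 the initial state of these registers. $H_k(x)$ is true if and only if the Hamming weight of $x$ is $k$. For an algorithm $\mathcal A$ given $N$, $Q^{\mathrm{rnd}}(\mathcal A)$ is its number of rounds, and $Q_G^{\mathrm{bit}}(\mathcal A)$ is the number of (qu)bits it sends on $G$ in total, over all rounds, links and directions, in the worst case over all quantum inputs, where for each round and each direction of each link one counts the maximal length of a message that occurs with nonzero amplitude. **Theorem.** There is a universal constant $C$ such that for every algorithm $\mathcal H_0$ there is an algorithm $\mathcal H_1$ with the following property. For every $N$ and every anonymous quantum network $G$ with $n\le N$ parties on which $\mathcal H_0$, given $N$, is an $H_0$-algorithm, the algorithm $\mathcal H_1$, given $N$, is a garbage-free $H_1$-algorithm on $G$; it runs in at most $C\cdot Q^{\mathrm{rnd}}(\mathcal H_0)$ rounds, and $$Q_G^{\mathrm{bit}}(\mathcal H_1)\le C\cdot N\cdot Q_G^{\mathrm{bit}}(\mathcal H_0).$$ In particular, if only an upper bound $N$ of the number $n$ of parties is given to every party and $\mathcal H_0$ computes $H_0$ on all networks with at most $N$ parties, then $H_1$ can be computed exactly, without intermediate measurements and for every quantum input, in $O(Q^{\mathrm{rnd}}(\mathcal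 H_0))$ rounds with bit complexity $O(N\cdot Q^{\mathrm{bit}}(\mathcal H_0))$ on every anonymous quantum network of unknown topology with at most $N$ parties. -/

import Mathlib

noncomputable section

namespace AnonNet

/-- A network of `n` parties: a connected simple undirected graph with an arbitrary port numbering.
Party `v` has `deg v` ports, in bijection with its neighbours (equivalently, with its links).  The
indices `v : Fin n` are only used to describe the network; no party knows its own index. -/
structure Network (n : ℕ) where
  graph : SimpleGraph (Fin n)
  connected : graph.Connected
  deg : Fin n → ℕ
  port : ∀ v, Fin (deg v) ≃ graph.neighborSet v

namespace Network

variable {n : ℕ} (W : Network n)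

/-- The party at the other end of the link attached to port `i` of party `v`. -/
def nbr (v : Fin n) (i : Fin (W.deg v)) : Fin n := (W.port v i : Fin n)

/-- The number of the port by which that link is attached to the party at the other end. -/
def opp (v : Fin n) (i : Fin (W.deg v)) : Fin (W.deg (W.nbr v i)) :=
  (W.port (W.nbr v i)).symm ⟨v, (W.port v i).2.symm⟩

end Network

/-- A message: a binary word of length at most `L`.  The empty word means that nothing is sent. -/
def Word (L : ℕ) : Type := Σ k : Fin (L + 1), (Fin (k : ℕ) → Bool)

instance (L : ℕ) : Fintype (Word L) :=
  inferInstanceAs (Fintype (Σ k : Fin (L + 1), (Fin (k : ℕ) → Bool)))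

instance (L : ℕ) : DecidableEq (Word L) :=
  inferInstanceAs (DecidableEq (Σ k : Fin (L + 1), (Fin (k : ℕ) → Bool)))

/-- The number of bits of a message. -/
def Word.length {L : ℕ} (w : Word L) : ℕ := (w.1 : ℕ)

/-- The empty word, i.e. no message. -/
def Word.empty (L : ℕ) : Word L := ⟨0, fun _ => false⟩

/-- Basis of the ancillary registers of a party with `d` ports: the work memory, and for each port a
message register.  -/
abbrev Anc (M : Type) (L d : ℕ) : Type := M × (Fin d → Word L)

/-- Basis of the Hilbert space of a party with `d` ports: the one-qubit input register `x`, the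
one-qubit output register `y`, and the ancillary registers. -/
abbrev Conf (M : Type) (L d : ℕ) : Type := Bool × Bool × Anc M L d

/-- A (synchronous) algorithm without intermediate measurements on anonymous quantum networks, all
of whose parties are given a number `N`.  All parties run the same algorithm: everything a party
does depends only on `N` and on its number `d` of ports. -/
structure Algorithm where
  /-- basis of the work memory of a party with `d` ports -/
  Mem : (N d : ℕ) → Type
  [memFintype : ∀ N d, Fintype (Mem N d)]
  [memDecEq : ∀ N d, DecidableEq (Mem N d)]
  /-- initial content of the work memory -/
  start : ∀ N d, Mem N d
  /-- bound on the length of a single message -/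
  maxLen : (N : ℕ) → ℕ
  /-- number of communication rounds -/
  rounds : (N : ℕ) → ℕ
  /-- `op N d r` is the unitary operation that a party with `d` ports applies to its own registers
  after `r` communication rounds: it processes the messages received in round `r` and prepares the
  messages to be sent in round `r + 1`. -/
  op : ∀ N d, (r : ℕ) → Matrix.unitaryGroup (Conf (Mem N d) (maxLen N) d) ℂ

attribute [instance] Algorithm.memFintype Algorithm.memDecEq

/-- Quantum inputs: unit vectors `∑ x, α x • |x⟩` of the `n`-qubit space. -/
def Input (n : ℕ) : Type := {α : (Fin n → Bool) → ℂ // ∑ x, ‖α x‖ ^ 2 = 1}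

namespace Algorithm

variable (A : Algorithm) (N : ℕ) {n : ℕ} (W : Network n)

/-- Computational basis of the Hilbert space of the whole network. -/
abbrev GConf : Type := ∀ v : Fin n, Conf (A.Mem N (W.deg v)) (A.maxLen N) (W.deg v)

/-- Computational basis of the ancillary registers of the whole network. -/
abbrev GAnc : Type := ∀ v : Fin n, Anc (A.Mem N (W.deg v)) (A.maxLen N) (W.deg v)

/-- Vectors of the Hilbert space of the whole network, given by their amplitudes. -/
abbrev State : Type := A.GConf N W → ℂ

variable {A N W} in
/-- Content of the input registers. -/
def inputs (c : A.GConf N W) : Fin n → Bool := fun v => (c v).1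

variable {A N W} in
/-- Content of the ancillary registers. -/
def anc (c : A.GConf N W) : A.GAnc N W := fun v => (c v).2.2

variable {A N W} in
/-- Content of the message register at port `i` of party `v`. -/
def msg (c : A.GConf N W) (v : Fin n) (i : Fin (W.deg v)) : Word (A.maxLen N) := (c v).2.2.2 i

/-- Initial content of the ancillary registers: the memories are in their initial state and there
are no messages. -/
def initAnc : A.GAnc N W := fun v => (A.start N (W.deg v), fun _ => Word.empty _)

/-- The vector with amplitude `α x * g x a` at the basis state in which the input registers hold
`x`, the ancillary registers hold `a`, and all output registers hold the bit `f x`: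
`∑ x, α x • (⨂ v, |x v⟩ |f x⟩) ⊗ |g x⟩`. -/
def distributed (α : (Fin n → Bool) → ℂ) (f : (Fin n → Bool) → Bool)
    (g : (Fin n → Bool) → A.GAnc N W → ℂ) : A.State N W :=
  open Classical in
  fun c => if ∀ v, (c v).2.1 = f (inputs c) then α (inputs c) * g (inputs c) (anc c) else 0

/-- The ancillary vector `|initAnc⟩`. -/
def cleanAnc : A.GAnc N W → ℂ := open Classical in fun a => if a = A.initAnc N W then 1 else 0

/-- Initial state: input `α`, all output registers hold `true`, ancillas are initialized. -/
def initState (α : (Fin n → Bool) → ℂ) : A.State N W :=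
  A.distributed N W α (fun _ => true) (fun _ => A.cleanAnc N W)

/-- All parties simultaneously apply their `r`-th local operation (a tensor product of unitaries). -/
def localStep (r : ℕ) (ψ : A.State N W) : A.State N W :=
  fun c => ∑ c' : A.GConf N W,
    (∏ v, (A.op N (W.deg v) r : Matrix _ _ ℂ) (c v) (c' v)) * ψ c'

variable {A N W} in
/-- Message passing on basis states: each link exchanges the contents of the two message registers
at its ends. -/
def deliver (c : A.GConf N W) : A.GConf N W :=
  fun v => ((c v).1, (c v).2.1, (c v).2.2.1, fun i => msg c (W.nbr v i) (W.opp v i))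

/-- Message passing (a permutation of the basis states that is its own inverse). -/
def exchange (ψ : A.State N W) : A.State N W := fun c => ψ (deliver c)

/-- State after `r` rounds followed by the `r`-th local operations, i.e. just before the messages of
round `r + 1` are delivered. -/
def stateAt (α : (Fin n → Bool) → ℂ) : ℕ → A.State N W
  | 0 => A.localStep N W 0 (A.initState N W α)
  | r + 1 => A.localStep N W (r + 1) (A.exchange N W (stateAt α r))

/-- State at the end of the algorithm. -/
def finalState (α : (Fin n → Bool) → ℂ) : A.State N W := A.stateAt N W α (A.rounds N)

/-- On the network `W`, with `N` given to all parties, the algorithm exactly computes `f`: every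
input `∑ x, α x • ⨂ v, |x v⟩ |true⟩` with initialized ancillas is transformed into
`∑ x, α x • (⨂ v, |x v⟩ |f x⟩) ⊗ |g x⟩` for some garbage vectors `|g x⟩`. -/
def ExactlyComputes (f : (Fin n → Bool) → Bool) : Prop :=
  ∃ g : (Fin n → Bool) → A.GAnc N W → ℂ,
    ∀ α : Input n, A.finalState N W α.1 = A.distributed N W α.1 f g

/-- As `ExactlyComputes`, but moreover no garbage is left: all ancillas are returned to their
initial state. -/
def CleanlyComputes (f : (Fin n → Bool) → Bool) : Prop :=
  ∀ α : Input n, A.finalState N W α.1 = A.distributed N W α.1 f (fun _ => A.cleanAnc N W)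

/-- Round complexity.  Since nothing is measured, it does not depend on the input. -/
def roundComplexity : ℕ := A.rounds N

/-- Number of bits (qubits) sent through port `i` of party `v` in round `r + 1`: the maximal length
of a message that occurs with nonzero amplitude.  (So a link counts as used if it is used in at
least one branch of the superposition.) -/
def bitsSent (α : (Fin n → Bool) → ℂ) (r : ℕ) (v : Fin n) (i : Fin (W.deg v)) : ℕ∞ :=
  ⨆ c : A.GConf N W, ⨆ _ : A.stateAt N W α r c ≠ 0, ((msg c v i).length : ℕ∞)

/-- Bit complexity: the total number of bits (qubits) sent over all links, in both directions and in
all rounds, in the worst case over all quantum inputs. -/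
def bitComplexity : ℕ∞ :=
  ⨆ α : Input n, ∑ r ∈ Finset.range (A.rounds N), ∑ v, ∑ i, A.bitsSent N W α.1 r v i

end Algorithm

/-- `H k x` is true iff the Hamming weight of `x` is `k`. -/
def H {n : ℕ} (k : ℕ) (x : Fin n → Bool) : Bool :=
  decide ((Finset.univ.filter fun v => x v = true).card = k)

end AnonNet

end

/-! Let `S` be the set of parties with input `1`. For each guess `m ≤ N` of `|S|`, every party holds
a three-valued register and a flag. An `H 0` query in which a party of `S` holding a value other
than `i` enters `true` tells whether all of `S` holds `i`; three such queries decide whether `S`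
agrees.

The register is prepared with `P m`, the flag records agreement, and where the flag is set the
register is rotated by `U m`. If `m = |S| ≥ 2`, the amplitude of agreement on `i` after the rotation
is a multiple of `∑ j, (U i j * P j 0) ^ m`. Suitable matrices make this vanish for all `i`
(`exists_desynchronizing`), because `0` is a convex combination of three `m`-th roots of `-1`. Hence
test `m` certainly ends in disagreement (`desync_flagged_prepare_blank`).

The output stays `true` iff in every test exactly one value is held by all of `S`. If `|S| = 0`, all
three values qualify vacuously; if `|S| = 1`, exactly one does; if `|S| ≥ 2`, the test with the
correct guess has none. So the output is `H 1 x` on the whole support, whatever the registers hold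
(`answered_outputAnswer`). The output therefore is not entangled with the tests beyond `x`, and
preparation, flags and rotation can be undone exactly.

All `3 * (N + 1)` queries of a block run as parallel copies of the given algorithm, their messages
packed into one per port. After an answer has been used, the copies run backwards, which removes the
garbage (`run_block`). The bit count rests on one generic quantum input in which no amplitude
cancels: it bounds the worst classical traffic of all links and rounds at once
(`sum_classicalTraffic_le`). -/

noncomputable section

namespace AnonNet

/-! ### Tensor products of matrices, controlled unitaries and basis permutations. -/

section LinearAlgebra

open Matrix

variable {ι : Type*} [Fintype ι] {S : ι → Type*}

/-- The tensor product of a family of square matrices. -/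
def piMat (U : ∀ v, Matrix (S v) (S v) ℂ) : Matrix (∀ v, S v) (∀ v, S v) ℂ :=
  fun c c' => ∏ v, U v (c v) (c' v)

theorem piMat_mul [DecidableEq ι] [∀ v, Fintype (S v)] (U V : ∀ v, Matrix (S v) (S v) ℂ) :
    piMat U * piMat V = piMat fun v => U v * V v := by
  ext c c'
  simp only [piMat, Matrix.mul_apply, Finset.prod_univ_sum, Fintype.piFinset_univ,
    Finset.prod_mul_distrib]

theorem piMat_one [∀ v, DecidableEq (S v)] : piMat (fun v => (1 : Matrix (S v) (S v) ℂ)) = 1 := by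
  ext c c'
  simp only [piMat, Matrix.one_apply, Finset.prod_ite_zero, funext_iff]
  simp

theorem piMat_conjTranspose (U : ∀ v, Matrix (S v) (S v) ℂ) :
    (piMat U)ᴴ = piMat fun v => (U v)ᴴ := by
  ext c c'
  simp [piMat, Matrix.conjTranspose_apply]

theorem piMat_mem_unitaryGroup [DecidableEq ι] [∀ v, Fintype (S v)] [∀ v, DecidableEq (S v)] (U : ∀ v, unitaryGroup (S v) ℂ) :
    piMat (fun v => (U v : Matrix (S v) (S v) ℂ)) ∈ unitaryGroup (∀ v, S v) ℂ := by
  rw [mem_unitaryGroup_iff, star_eq_conjTranspose, piMat_conjTranspose, piMat_mul, ← piMat_one]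
  congr 1
  funext v
  exact mem_unitaryGroup_iff.1 (U v).2

/-- The tensor product of a family of unitary matrices. -/
def piUnitary [DecidableEq ι] [∀ v, Fintype (S v)] [∀ v, DecidableEq (S v)] (U : ∀ v, unitaryGroup (S v) ℂ) : unitaryGroup (∀ v, S v) ℂ :=
  ⟨_, piMat_mem_unitaryGroup U⟩

/-- A tensor product of matrices maps product vectors to product vectors. -/
theorem piMat_mulVec_prod [DecidableEq ι] [∀ v, Fintype (S v)] (U : ∀ v, Matrix (S v) (S v) ℂ) (f : ∀ v, S v → ℂ) :
    piMat U *ᵥ (fun c => ∏ v, f v (c v)) = fun c => ∏ v, (U v *ᵥ f v) (c v) := by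
  funext c
  simp only [piMat, Matrix.mulVec, dotProduct, Finset.prod_univ_sum, Fintype.piFinset_univ,
    Finset.prod_mul_distrib]

/-- Transposing the array of registers groups the factors by copy `t` instead of by party `v`. This
lets each parallel copy evolve as if it were alone. -/
theorem piMat_swap_mulVec [DecidableEq ι] {τ : Type*} [Fintype τ] [DecidableEq τ]
    {X : ι → τ → Type*} [∀ v t, Fintype (X v t)]
    (K : ∀ v t, Matrix (X v t) (X v t) ℂ) (φ : ∀ t, (∀ v, X v t) → ℂ) :
    piMat (fun v => piMat (K v)) *ᵥ (fun c => ∏ t, φ t (fun v => c v t)) =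
      fun c => ∏ t, (piMat (fun v => K v t) *ᵥ φ t) (fun v => c v t) := by
  have h := piMat_mulVec_prod (fun t => piMat (fun v => K v t)) φ
  funext c
  have hc := congrFun h (fun t v => c v t)
  refine Eq.trans ?_ hc
  simp only [mulVec, dotProduct]
  refine Fintype.sum_equiv (Equiv.piComm X) _ _ fun c' => ?_
  simp only [piMat]
  rw [Finset.prod_comm]
  rfl

/-- A unitary operation on the first part of a register that is controlled by the second part. -/
def controlledMat {R P Q : Type*} [DecidableEq Q] (e : R ≃ P × Q) (K : Q → Matrix P P ℂ) :
    Matrix R R ℂ :=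
  (Matrix.blockDiagonal K).submatrix e e

theorem controlledMat_apply {R P Q : Type*} [DecidableEq Q] (e : R ≃ P × Q)
    (K : Q → Matrix P P ℂ) (c c' : R) :
    controlledMat e K c c' =
      if (e c).2 = (e c').2 then K (e c).2 (e c).1 (e c').1 else 0 := by
  simp [controlledMat, Matrix.blockDiagonal_apply]

theorem controlledMat_mem_unitaryGroup {R P Q : Type*} [Fintype R] [DecidableEq R] [Fintype P]
    [DecidableEq P] [Fintype Q] [DecidableEq Q] (e : R ≃ P × Q) (K : Q → unitaryGroup P ℂ) :
    controlledMat e (fun q => (K q : Matrix P P ℂ)) ∈ unitaryGroup R ℂ := by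
  rw [mem_unitaryGroup_iff, star_eq_conjTranspose, controlledMat, conjTranspose_submatrix,
    submatrix_mul_equiv, blockDiagonal_conjTranspose, ← blockDiagonal_mul]
  have : (fun q => (K q : Matrix P P ℂ) * (K q : Matrix P P ℂ)ᴴ) = 1 := by
    funext q
    exact mem_unitaryGroup_iff.1 (K q).2
  rw [this, blockDiagonal_one, submatrix_one_equiv]

/-- `controlledMat` as a unitary matrix. -/
def controlled {R P Q : Type*} [Fintype R] [DecidableEq R] [Fintype P]
    [DecidableEq P] [Fintype Q] [DecidableEq Q] (e : R ≃ P × Q) (K : Q → unitaryGroup P ℂ) :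
    unitaryGroup R ℂ :=
  ⟨_, controlledMat_mem_unitaryGroup e K⟩

/-- Controls are never changed, so only configurations with the same controls as `c` contribute;
they are parametrized by the target parts `p`. -/
theorem piMat_controlled_mulVec {P Q : ι → Type*} [∀ v, Fintype (P v)]
    [∀ v, DecidableEq (Q v)] [DecidableEq ι] [∀ v, Fintype (S v)]
    (e : ∀ v, S v ≃ P v × Q v) (K : ∀ v, Q v → Matrix (P v) (P v) ℂ) (ψ : (∀ v, S v) → ℂ)
    (c : ∀ v, S v) :
    (piMat (fun v => controlledMat (e v) (K v)) *ᵥ ψ) c =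
      (piMat (fun v => K v (e v (c v)).2) *ᵥ
        fun p => ψ fun v => (e v).symm (p v, (e v (c v)).2)) fun v => (e v (c v)).1 := by
  simp only [mulVec, dotProduct]
  symm
  refine Fintype.sum_of_injective
    (fun (p : ∀ v, P v) (v : ι) => (e v).symm (p v, (e v (c v)).2)) ?_ _ _ ?_ ?_
  · intro p p' h
    funext v
    have := congrArg (e v) (congrFun h v)
    simpa using this
  · intro c' hc'
    have : ∃ v, (e v (c v)).2 ≠ (e v (c' v)).2 := by
      by_contra! hne
      exact hc' ⟨fun v => (e v (c' v)).1, by funext v; simp [hne v]⟩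
    obtain ⟨v, hv⟩ := this
    have : piMat (fun v => controlledMat (e v) (K v)) c c' = 0 := by
      refine Finset.prod_eq_zero (Finset.mem_univ v) ?_
      exact (controlledMat_apply _ _ _ _).trans (if_neg hv)
    rw [this, zero_mul]
  · intro p
    simp [piMat, controlledMat_apply]

/-- The unitary matrix of an involution of the computational basis. -/
def permUnitary {R : Type*} [Fintype R] [DecidableEq R] (σ : R → R)
    (hσ : Function.Involutive σ) : unitaryGroup R ℂ :=
  ⟨Matrix.of fun c c' => if σ c = c' then 1 else 0, by
    rw [mem_unitaryGroup_iff]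
    ext c c'
    simp [Matrix.mul_apply, Matrix.one_apply, Matrix.star_apply, hσ.injective.eq_iff,
      eq_comm (a := c)]⟩

theorem piMat_permUnitary_mulVec [DecidableEq ι] [∀ v, Fintype (S v)] [∀ v, DecidableEq (S v)] (σ : ∀ v, S v → S v)
    (hσ : ∀ v, Function.Involutive (σ v)) (ψ : (∀ v, S v) → ℂ) :
    piMat (fun v => (permUnitary (σ v) (hσ v) : Matrix (S v) (S v) ℂ)) *ᵥ ψ =
      fun c => ψ fun v => σ v (c v) := by
  funext c
  simp only [mulVec, dotProduct, piMat, permUnitary, Matrix.of_apply, Finset.prod_ite_zero,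
    Finset.prod_const_one, Finset.mem_univ, true_imp_iff, ite_mul, one_mul, zero_mul]
  simp_rw [← funext_iff (f := fun v => σ v (c v))]
  simp

theorem piMat_inv_mulVec_mulVec [DecidableEq ι] [∀ v, Fintype (S v)] [∀ v, DecidableEq (S v)] (U : ∀ v, unitaryGroup (S v) ℂ)
    (ψ : (∀ v, S v) → ℂ) :
    piMat (fun v => ((U v)⁻¹ : unitaryGroup (S v) ℂ).1) *ᵥ (piMat (fun v => (U v).1) *ᵥ ψ) = ψ := by
  rw [mulVec_mulVec, piMat_mul]
  have : (fun v => ((U v)⁻¹ : unitaryGroup (S v) ℂ).1 * (U v).1) = fun v => 1 := by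
    funext v
    exact mem_unitaryGroup_iff'.1 (U v).2
  rw [this, piMat_one, one_mulVec]

end LinearAlgebra

/-! ### Injective packing of families of messages, and reversible transfer between registers. -/

section Words

/-- The bits of a message. -/
def Word.toList {L : ℕ} (w : Word L) : List Bool := List.ofFn w.2

theorem Word.toList_length {L : ℕ} (w : Word L) : w.toList.length = w.length := by
  simp [Word.toList, Word.length]

theorem Word.toList_injective {L : ℕ} : Function.Injective (Word.toList (L := L)) := by
  rintro ⟨⟨k, hk⟩, f⟩ ⟨⟨k', hk'⟩, f'⟩ h
  have := List.ofFn_inj'.1 h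
  simp only [Sigma.mk.injEq] at this
  obtain ⟨h1, h2⟩ := this
  subst h1
  obtain rfl := eq_of_heq h2
  rfl

/-- The message with given bits. -/
def Word.ofList {L : ℕ} (l : List Bool) (h : l.length ≤ L) : Word L :=
  ⟨⟨l.length, Nat.lt_succ_of_le h⟩, l.get⟩

theorem Word.toList_ofList {L : ℕ} (l : List Bool) (h : l.length ≤ L) :
    (Word.ofList l h).toList = l := by
  simp [Word.toList, Word.ofList]

theorem Word.toList_empty (L : ℕ) : (Word.empty L).toList = [] := by
  simp [Word.toList, Word.empty]

theorem Word.length_empty (L : ℕ) : (Word.empty L).length = 0 := rfl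

theorem Word.length_le {L : ℕ} (w : Word L) : w.length ≤ L := Nat.le_of_lt_succ w.1.2

theorem Word.eq_empty_iff {L : ℕ} (w : Word L) : w = Word.empty L ↔ w.length = 0 := by
  rw [← Word.toList_injective.eq_iff, Word.toList_empty, ← Word.toList_length,
    List.length_eq_zero_iff]

/-- A self-delimiting code for binary words. -/
def delimit : List Bool → List Bool
  | [] => [false]
  | b :: l => true :: b :: delimit l

theorem delimit_length (l : List Bool) : (delimit l).length = 2 * l.length + 1 := by
  induction l with
  | nil => rfl
  | cons b l ih => simp only [delimit, List.length_cons, ih]; ring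

theorem delimit_append_inj : ∀ {l l' r r' : List Bool},
    delimit l ++ r = delimit l' ++ r' → l = l' ∧ r = r'
  | [], [], r, r', h => by simpa [delimit] using h
  | [], b :: l', r, r', h => by simp [delimit] at h
  | b :: l, [], r, r', h => by simp [delimit] at h
  | b :: l, b' :: l', r, r', h => by
    simp only [delimit, List.cons_append, List.cons.injEq, true_and] at h
    obtain ⟨rfl, h⟩ := h
    obtain ⟨rfl, rfl⟩ := delimit_append_inj h
    exact ⟨rfl, rfl⟩

theorem flatMap_delimit_inj {T : Type*} {f f' : T → List Bool} (ts : List T)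
    (h : ts.flatMap (fun t => delimit (f t)) = ts.flatMap (fun t => delimit (f' t))) :
    ∀ t ∈ ts, f t = f' t := by
  induction ts with
  | nil => simp
  | cons t ts ih =>
    simp only [List.flatMap_cons] at h
    obtain ⟨h1, h2⟩ := delimit_append_inj h
    intro s hs
    rcases List.mem_cons.1 hs with rfl | hs
    · exact h1
    · exact ih h2 s hs

theorem flatMap_delimit_length_le {T : Type*} {f : T → List Bool} {m : ℕ} (ts : List T)
    (h : ∀ t ∈ ts, (f t).length ≤ m) :
    (ts.flatMap (fun t => delimit (f t))).length ≤ ts.length * (2 * m + 1) := by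
  induction ts with
  | nil => simp
  | cons t ts ih =>
    simp only [List.flatMap_cons, List.length_append, delimit_length, List.length_cons]
    have h1 := h t (by simp)
    have h2 := ih fun s hs => h s (by simp [hs])
    nlinarith

variable (T : Type) [Fintype T] (L : ℕ)

/-- Length of the messages that suffices to pack a `T`-indexed family of messages. -/
abbrev packLen : ℕ := Fintype.card T * (2 * L + 1)

variable {T L}

/-- Packs a family of messages into one message; nothing is sent if all messages are empty. -/
def pack (w : T → Word L) : Word (packLen T L) :=
  open Classical in
  if w = fun _ => Word.empty L then Word.empty _
  else Word.ofList ((Finset.univ : Finset T).toList.flatMap fun t => delimit (w t).toList) (by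
    refine (flatMap_delimit_length_le (m := L) _ fun t _ => ?_).trans ?_
    · rw [Word.toList_length]
      exact (w t).length_le
    · simp)

theorem pack_empty : pack (fun _ : T => Word.empty L) = Word.empty _ := by
  simp [pack]

theorem pack_length_le {w : T → Word L} {m : ℕ} (h : ∀ t, (w t).length ≤ m) :
    (pack w).length ≤ 3 * Fintype.card T * m := by
  rw [pack]
  split_ifs with hw
  · simp [Word.length_empty]
  -- A nonempty message forces `m ≥ 1`, so `2 * m + 1 ≤ 3 * m`: the delimiters cost only a constant
  -- factor. Sending nothing for the empty family is what makes this bound possible on idle links.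
  · have hm : 1 ≤ m := by
      by_contra hm
      refine hw (funext fun t => (Word.eq_empty_iff _).2 ?_)
      have := h t
      omega
    rw [← Word.toList_length, Word.toList_ofList]
    refine (flatMap_delimit_length_le (m := m) _ fun t _ => ?_).trans ?_
    · rw [Word.toList_length]
      exact h t
    · simp only [Finset.length_toList, Finset.card_univ]
      nlinarith [Nat.zero_le (Fintype.card T)]

/-- Every delimited word has at least one bit, so only the empty family is coded by the empty word;
the other families are separated by prefix-freeness. -/
theorem pack_injective : Function.Injective (pack (T := T) (L := L)) := by
  have key : ∀ w : T → Word L, w ≠ (fun _ => Word.empty L) → pack w ≠ Word.empty _ := by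
    intro w hw h
    rw [pack, if_neg hw, ← Word.toList_injective.eq_iff, Word.toList_ofList, Word.toList_empty,
      List.flatMap_eq_nil_iff] at h
    refine hw (funext fun t => ?_)
    have := h t (by simp)
    apply_fun List.length at this
    simp [delimit_length] at this
  intro w w' h
  by_cases hw : w = fun _ => Word.empty L
  · by_contra hne
    refine key w' (fun h' => hne (hw.trans h'.symm)) ?_
    rw [← h, hw, pack_empty]
  by_cases hw' : w' = fun _ => Word.empty L
  · exact absurd (by rw [h, hw', pack_empty]) (key w hw)
  rw [pack, pack, if_neg hw, if_neg hw', ← Word.toList_injective.eq_iff, Word.toList_ofList,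
    Word.toList_ofList] at h
  funext t
  exact Word.toList_injective (flatMap_delimit_inj _ h t (by simp))

/-- The involution that moves a value from one register to another one, encoded by `f`. -/
def transfer {X Y : Type*} (f : X → Y) (x₀ : X) (p : X × Y) : X × Y :=
  open Classical in
  if p.2 = f x₀ then (x₀, f p.1)
  else if h : p.1 = x₀ ∧ ∃ x, f x = p.2 then (h.2.choose, f x₀) else p

theorem transfer_right {X Y : Type*} {f : X → Y} (x₀ x : X) :
    transfer f x₀ (x, f x₀) = (x₀, f x) := by
  simp [transfer]

theorem transfer_left {X Y : Type*} {f : X → Y} (hf : Function.Injective f) (x₀ x : X) :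
    transfer f x₀ (x₀, f x) = (x, f x₀) := by
  by_cases hx : f x = f x₀
  · obtain rfl := hf hx
    simp [transfer]
  · have h : x₀ = x₀ ∧ ∃ x', f x' = f x := ⟨rfl, x, rfl⟩
    have := hf h.2.choose_spec
    simp [transfer, hx, this]

/-- The map swaps `(x, f x₀)` with `(x₀, f x)` and fixes all other pairs; injectivity of `f` makes
this pairing consistent. -/
theorem transfer_involutive {X Y : Type*} {f : X → Y} (hf : Function.Injective f) (x₀ : X) :
    Function.Involutive (transfer f x₀) := by
  rintro ⟨x, y⟩
  by_cases hy : y = f x₀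
  · subst hy
    rw [transfer_right, transfer_left hf]
  by_cases h : x = x₀ ∧ ∃ x', f x' = y
  · obtain ⟨rfl, x', rfl⟩ := h
    rw [transfer_left hf, transfer_right]
  · have : transfer f x₀ (x, y) = (x, y) := by simp [transfer, hy, h]
    rw [this, this]

end Words

/-! ### Reversal of directed links. -/

section Networks

namespace Network

variable {n : ℕ} (W : Network n)

theorem nbr_opp (v : Fin n) (i : Fin (W.deg v)) : W.nbr (W.nbr v i) (W.opp v i) = v :=
  congrArg Subtype.val
    (Equiv.apply_symm_apply (W.port (W.nbr v i)) ⟨v, (W.port v i).2.symm⟩)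

/-- The directed link in the opposite direction. -/
def reverse (p : Σ v, Fin (W.deg v)) : Σ v, Fin (W.deg v) := ⟨W.nbr p.1 p.2, W.opp p.1 p.2⟩

theorem reverse_involutive : Function.Involutive W.reverse := by
  rintro ⟨v, i⟩
  -- The port index has a type depending on the party, so the party is generalized to `u` before
  -- substituting `u = v`.
  have key : ∀ (u : Fin n) (hu : u = v) (h : W.nbr v i ∈ W.graph.neighborSet u),
      (⟨u, (W.port u).symm ⟨W.nbr v i, h⟩⟩ : Σ v, Fin (W.deg v)) = ⟨v, i⟩ := by
    rintro u rfl h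
    congr 1
    rw [Equiv.symm_apply_eq]
    rfl
  exact key _ (W.nbr_opp v i) _

theorem sum_reverse {M : Type*} [AddCommMonoid M] (F : ∀ v, Fin (W.deg v) → M) :
    ∑ v, ∑ i, F (W.nbr v i) (W.opp v i) = ∑ v, ∑ i, F v i := by
  have h := Equiv.sum_comp W.reverse_involutive.toPerm (fun p => F p.1 p.2)
  rw [← Finset.univ_sigma_univ, Finset.sum_sigma, Finset.sum_sigma] at h
  exact h

end Network

end Networks

namespace Algorithm

/-! ### Circuits of local operations and exchanges, with their effect and cost. -/

section Circuits

open Matrix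

/-- A local operation that all parties apply, depending only on the number of ports. -/
abbrev Local (A : Algorithm) (N : ℕ) : Type :=
  ∀ d, unitaryGroup (Conf (A.Mem N d) (A.maxLen N) d) ℂ

/-- A sequence of local operations (`some u`) and message exchanges (`none`). -/
abbrev Circuit (A : Algorithm) (N : ℕ) : Type := List (Option (A.Local N))

variable {A : Algorithm} {N : ℕ}

/-- The product of the local operations between the `r`-th and the next exchange of a circuit. -/
def circuitOp : A.Circuit N → ℕ → A.Local N
  | [], _ => fun _ => 1
  | some u :: l, 0 => fun d => circuitOp l 0 d * u d
  | some _ :: l, r + 1 => circuitOp l (r + 1)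
  | none :: _, 0 => fun _ => 1
  | none :: l, r + 1 => circuitOp l r

/-- The number of exchanges of a circuit. -/
def exchanges (l : A.Circuit N) : ℕ := l.countP Option.isNone

variable (A) in
/-- The algorithm with the registers of `A` that performs given circuits. -/
def withCircuit (l : ∀ N, A.Circuit N) : Algorithm where
  Mem := A.Mem
  start := A.start
  maxLen := A.maxLen
  rounds N := exchanges (l N)
  op N d r := circuitOp (l N) r d

variable {n : ℕ} {W : Network n}

/-- All parties apply a local operation. -/
def applyLocal (u : A.Local N) (ψ : A.State N W) : A.State N W :=
  piMat (fun v => (u (W.deg v)).1) *ᵥ ψ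

theorem applyLocal_mul (u u' : A.Local N) (ψ : A.State N W) :
    applyLocal (fun d => u d * u' d) ψ = applyLocal u (applyLocal u' ψ) := by
  simp [applyLocal, mulVec_mulVec, piMat_mul]

theorem applyLocal_one (ψ : A.State N W) : applyLocal (fun _ => 1) ψ = ψ := by
  simp [applyLocal, piMat_one]

theorem applyLocal_inv (u : A.Local N) (ψ : A.State N W) :
    applyLocal (fun d => (u d)⁻¹) (applyLocal u ψ) = ψ :=
  piMat_inv_mulVec_mulVec _ ψ

/-- Number of bits that are sent through a port if the current state is `ψ`. -/
def sentThrough (ψ : A.State N W) (v : Fin n) (i : Fin (W.deg v)) : ℕ∞ :=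
  ⨆ c : A.GConf N W, ⨆ _ : ψ c ≠ 0, ((msg c v i).length : ℕ∞)

theorem sentThrough_le {ψ : A.State N W} {v : Fin n} {i : Fin (W.deg v)} {b : ℕ∞}
    (h : ∀ c, ψ c ≠ 0 → ((msg c v i).length : ℕ∞) ≤ b) : sentThrough ψ v i ≤ b :=
  iSup₂_le h

theorem le_sentThrough {ψ : A.State N W} (v : Fin n) (i : Fin (W.deg v)) {c : A.GConf N W}
    (h : ψ c ≠ 0) : ((msg c v i).length : ℕ∞) ≤ sentThrough ψ v i :=
  le_iSup₂ (f := fun (c : A.GConf N W) (_ : ψ c ≠ 0) => ((msg c v i).length : ℕ∞)) c h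

/-- The effect of a circuit. -/
def run : A.Circuit N → A.State N W → A.State N W
  | [], ψ => ψ
  | some u :: l, ψ => run l (applyLocal u ψ)
  | none :: l, ψ => run l (A.exchange N W ψ)

/-- Total number of bits sent by a circuit. -/
def cost : A.Circuit N → A.State N W → ℕ∞
  | [], _ => 0
  | some u :: l, ψ => cost l (applyLocal u ψ)
  | none :: l, ψ => ∑ v, ∑ i, sentThrough ψ v i + cost l (A.exchange N W ψ)

theorem run_append (l l' : A.Circuit N) (ψ : A.State N W) :
    run (l ++ l') ψ = run l' (run l ψ) := by
  induction l generalizing ψ with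
  | nil => rfl
  | cons s l ih => cases s <;> exact ih _

theorem cost_append (l l' : A.Circuit N) (ψ : A.State N W) :
    cost (l ++ l') ψ = cost l ψ + cost l' (run l ψ) := by
  induction l generalizing ψ with
  | nil => simp [cost, run]
  | cons s l ih =>
    cases s with
    | none => simp only [List.cons_append, cost, run, ih, add_assoc]
    | some u => simp only [List.cons_append, cost, run, ih]

theorem exchanges_append (l l' : A.Circuit N) :
    exchanges (l ++ l') = exchanges l + exchanges l' :=
  List.countP_append

/-- The states just before each exchange if the local operations `u` are used. -/
def trajectory (u : ℕ → A.Local N) (ψ : A.State N W) : ℕ → A.State N W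
  | 0 => applyLocal (u 0) ψ
  | r + 1 => applyLocal (u (r + 1)) (A.exchange N W (trajectory u ψ r))

theorem trajectory_some (u : A.Local N) (l : A.Circuit N) (ψ : A.State N W) (r : ℕ) :
    trajectory (circuitOp (some u :: l)) ψ r = trajectory (circuitOp l) (applyLocal u ψ) r := by
  induction r with
  | zero => simp only [trajectory, circuitOp, applyLocal_mul]
  | succ r ih => simp only [trajectory, circuitOp, ih]

/-- A leading exchange has the identity as the operation before it, which shifts the round index by
one. -/
theorem trajectory_none (l : A.Circuit N) (ψ : A.State N W) (r : ℕ) :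
    trajectory (circuitOp (none :: l)) ψ (r + 1) =
      trajectory (circuitOp l) (A.exchange N W ψ) r := by
  induction r with
  | zero => simp only [trajectory, circuitOp, applyLocal_one]
  | succ r ih => rw [trajectory, ih, trajectory, circuitOp]

theorem trajectory_exchanges (l : A.Circuit N) (ψ : A.State N W) :
    trajectory (circuitOp l) ψ (exchanges l) = run l ψ := by
  induction l generalizing ψ with
  | nil => simp [exchanges, trajectory, circuitOp, run, applyLocal_one]
  | cons s l ih =>
    cases s with
    | none =>
      rw [run, ← ih, ← trajectory_none]
      simp [exchanges]
    | some u =>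
      rw [run, ← ih, ← trajectory_some]
      simp [exchanges]

theorem sum_sentThrough_trajectory (l : A.Circuit N) (ψ : A.State N W) :
    ∑ r ∈ Finset.range (exchanges l), ∑ v, ∑ i,
      sentThrough (trajectory (circuitOp l) ψ r) v i = cost l ψ := by
  induction l generalizing ψ with
  | nil => simp [exchanges, cost]
  | cons s l ih =>
    cases s with
    | none =>
      have h : exchanges (none :: l) = exchanges l + 1 := by simp [exchanges]
      rw [h, Finset.sum_range_succ', cost, ← ih, add_comm]
      simp only [trajectory_none]
      simp only [trajectory, circuitOp, applyLocal_one]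
    | some u =>
      have h : exchanges (some u :: l) = exchanges l := by simp [exchanges]
      simp only [h, cost, ← ih, trajectory_some]

/-- Both algorithms have the same registers, and `localStep` unfolds to `applyLocal`; hence the
definitional equalities. -/
theorem stateAt_withCircuit (l : ∀ N, A.Circuit N) (α : (Fin n → Bool) → ℂ) (r : ℕ) :
    (A.withCircuit l).stateAt N W α r =
      trajectory (circuitOp (l N)) (A.initState N W α) r := by
  induction r with
  | zero => rfl
  | succ r ih => rw [stateAt, ih]; rfl

theorem finalState_withCircuit (l : ∀ N, A.Circuit N) (α : (Fin n → Bool) → ℂ) :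
    (A.withCircuit l).finalState N W α = run (l N) (A.initState N W α) := by
  rw [← trajectory_exchanges, ← stateAt_withCircuit]
  rfl

theorem sum_bitsSent_withCircuit (l : ∀ N, A.Circuit N) (α : (Fin n → Bool) → ℂ) :
    ∑ r ∈ Finset.range ((A.withCircuit l).rounds N), ∑ v, ∑ i,
      (A.withCircuit l).bitsSent N W α r v i = cost (l N) (A.initState N W α) := by
  rw [← sum_sentThrough_trajectory]
  simp only [← stateAt_withCircuit]
  rfl

theorem deliver_involutive : Function.Involutive (deliver : A.GConf N W → A.GConf N W) := by
  intro c
  funext v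
  refine Prod.ext rfl (Prod.ext rfl (Prod.ext rfl (funext fun i => ?_)))
  exact congrArg (fun p : Σ v, Fin (W.deg v) => msg c p.1 p.2) (W.reverse_involutive ⟨v, i⟩)

theorem exchange_exchange (ψ : A.State N W) : A.exchange N W (A.exchange N W ψ) = ψ := by
  funext c
  exact congrArg ψ (deliver_involutive c)

end Circuits

end Algorithm

namespace Algorithm

/-! ### Parallel copies of an algorithm inside the memory of a host. -/

section Host

open Matrix

set_option synthInstance.maxSize 2000
set_option linter.unusedSectionVars false

variable (A : Algorithm) (X T : ℕ → Type) [∀ N, Fintype (X N)] [∀ N, DecidableEq (X N)]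
  [∀ N, Fintype (T N)] [∀ N, DecidableEq (T N)] (x₀ : ∀ N, X N)

/-- An algorithm without any operations, whose memory consists of a data register and of all
registers of `T N` copies of `A`. -/
abbrev host : Algorithm where
  Mem N d := X N × (T N → Conf (A.Mem N d) (A.maxLen N) d)
  start N d := (x₀ N, fun _ => (false, true, A.start N d, fun _ => Word.empty _))
  maxLen N := packLen (T N) (A.maxLen N)
  rounds _ := 0
  op _ _ _ := 1

variable (N : ℕ)

/-- Basis of the Hilbert space of a party of the host algorithm. -/
abbrev HostConf (d : ℕ) : Type :=
  Conf (X N × (T N → Conf (A.Mem N d) (A.maxLen N) d)) (packLen (T N) (A.maxLen N)) d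

/-- Separates the data register from the other registers. -/
def dataEquiv (d : ℕ) : HostConf A X T N d ≃ X N × (Bool × Bool ×
    (T N → Conf (A.Mem N d) (A.maxLen N) d) × (Fin d → Word (packLen (T N) (A.maxLen N)))) where
  toFun c := (c.2.2.1.1, c.1, c.2.1, c.2.2.1.2, c.2.2.2)
  invFun p := (p.2.1, p.2.2.1, (p.1, p.2.2.2.1), p.2.2.2.2)
  left_inv _ := rfl
  right_inv _ := rfl

/-- Separates the registers of the copies of `A` from the other registers. -/
def instEquiv (d : ℕ) : HostConf A X T N d ≃ (T N → Conf (A.Mem N d) (A.maxLen N) d) ×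
    (Bool × Bool × X N × (Fin d → Word (packLen (T N) (A.maxLen N)))) where
  toFun c := (c.2.2.1.2, c.1, c.2.1, c.2.2.1.1, c.2.2.2)
  invFun p := (p.2.1, p.2.2.1, (p.2.2.2.1, p.1), p.2.2.2.2)
  left_inv _ := rfl
  right_inv _ := rfl

/-- An operation on the data register. -/
def dataLocal (K : unitaryGroup (X N) ℂ) : (A.host X T x₀).Local N :=
  fun d => controlled (dataEquiv A X T N d) fun _ => K

/-- A local operation of `A`, applied to all copies. -/
def instLocal (u : A.Local N) : (A.host X T x₀).Local N :=
  fun d => controlled (instEquiv A X T N d) fun _ => piUnitary fun _ : T N => u d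

variable {X T N} (ζ : T N → Bool → X N → Bool)

variable {A} in
/-- Adds the query bits to the input registers of the copies. -/
def loadConf {d : ℕ} (c : HostConf A X T N d) : HostConf A X T N d :=
  (c.1, c.2.1, (c.2.2.1.1, fun t =>
    (xor (ζ t c.1 c.2.2.1.1) (c.2.2.1.2 t).1, (c.2.2.1.2 t).2)), c.2.2.2)

theorem loadConf_involutive (d : ℕ) :
    Function.Involutive (loadConf ζ : HostConf A X T N d → HostConf A X T N d) := by
  intro c
  refine Prod.ext rfl (Prod.ext rfl (Prod.ext (Prod.ext rfl (funext fun t => ?_)) rfl))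
  refine Prod.ext ?_ rfl
  simp [loadConf]

/-- Adds the query bits to the input registers of the copies. -/
def loadLocal : (A.host X T x₀).Local N :=
  fun d => permUnitary (loadConf ζ) (loadConf_involutive A ζ d)

variable {A} in
/-- Exchanges the contents of the message registers of the copies, packed into one message for each
port, with the contents of the message registers of the host. -/
def packConf {d : ℕ} (c : HostConf A X T N d) : HostConf A X T N d :=
  (c.1, c.2.1, (c.2.2.1.1, fun t =>
    ((c.2.2.1.2 t).1, (c.2.2.1.2 t).2.1, (c.2.2.1.2 t).2.2.1, fun i =>
      (transfer pack (fun _ => Word.empty _)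
        ((fun t => (c.2.2.1.2 t).2.2.2 i), c.2.2.2 i)).1 t)), fun i =>
      (transfer pack (fun _ => Word.empty _) ((fun t => (c.2.2.1.2 t).2.2.2 i), c.2.2.2 i)).2)

theorem packConf_involutive (d : ℕ) :
    Function.Involutive (packConf : HostConf A X T N d → HostConf A X T N d) := by
  intro c
  have key : ∀ i, transfer pack (fun _ => Word.empty _)
      (transfer pack (fun _ => Word.empty _) ((fun t => (c.2.2.1.2 t).2.2.2 i), c.2.2.2 i)) =
      ((fun t => (c.2.2.1.2 t).2.2.2 i), c.2.2.2 i) :=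
    fun i => transfer_involutive pack_injective _ _
  refine Prod.ext rfl (Prod.ext rfl (Prod.ext (Prod.ext rfl (funext fun t => ?_))
    (funext fun i => congrArg Prod.snd (key i))))
  exact Prod.ext rfl (Prod.ext rfl (Prod.ext rfl
    (funext fun i => congrFun (congrArg Prod.fst (key i)) t)))

/-- `packConf` as a local operation. -/
def packLocal : (A.host X T x₀).Local N :=
  fun d => permUnitary packConf (packConf_involutive A d)

variable {A} in
/-- Changes output and data register depending on the output registers of the copies. -/
def answerConf (π : (T N → Bool) → Bool × X N → Bool × X N) {d : ℕ} (c : HostConf A X T N d) :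
    HostConf A X T N d :=
  (c.1, (π (fun t => (c.2.2.1.2 t).2.1) (c.2.1, c.2.2.1.1)).1,
    ((π (fun t => (c.2.2.1.2 t).2.1) (c.2.1, c.2.2.1.1)).2, c.2.2.1.2), c.2.2.2)

theorem answerConf_involutive {π : (T N → Bool) → Bool × X N → Bool × X N}
    (hπ : ∀ h, Function.Involutive (π h)) (d : ℕ) :
    Function.Involutive (answerConf π : HostConf A X T N d → HostConf A X T N d) := by
  intro c
  have key := hπ (fun t => (c.2.2.1.2 t).2.1) (c.2.1, c.2.2.1.1)
  have key₁ := congrArg Prod.fst key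
  have key₂ := congrArg Prod.snd key
  exact Prod.ext rfl (Prod.ext key₁ (Prod.ext (Prod.ext key₂ rfl) rfl))

/-- `answerConf` as a local operation. -/
def answerLocal {π : (T N → Bool) → Bool × X N → Bool × X N}
    (hπ : ∀ h, Function.Involutive (π h)) : (A.host X T x₀).Local N :=
  fun d => permUnitary (answerConf π) (answerConf_involutive A hπ d)

variable {A x₀} {n : ℕ} {W : Network n}

/-- Content of the data registers. -/
def dat (c : (A.host X T x₀).GConf N W) : Fin n → X N := fun v => (c v).2.2.1.1

/-- Content of the output registers. -/
def outputs (c : A.GConf N W) : Fin n → Bool := fun v => (c v).2.1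

/-- Content of the registers of a copy of `A`. -/
def inst (c : (A.host X T x₀).GConf N W) (t : T N) : A.GConf N W := fun v => (c v).2.2.1.2 t

/-- All message registers are empty. -/
def Silent (c : A.GConf N W) : Prop := ∀ v i, msg c v i = Word.empty _

/-- The query that is asked to a copy. -/
def query (t : T N) (x : Fin n → Bool) (χ : Fin n → X N) : Fin n → Bool :=
  fun v => ζ t (x v) (χ v)

/-- The state in which the input, output and data registers are in state `β`, the message registers
are empty, and, for queries `z`, the copies of `A` are in states `Ψ z`. -/
def joint (β : (Fin n → Bool) → (Fin n → Bool) → (Fin n → X N) → ℂ)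
    (Ψ : (Fin n → Bool) → A.State N W) : (A.host X T x₀).State N W :=
  open Classical in
  fun c => if Silent c then β (inputs c) (outputs c) (dat c) *
    ∏ t, Ψ (query ζ t (inputs c) (dat c)) (inst c t) else 0

theorem applyLocal_dataLocal (K : unitaryGroup (X N) ℂ)
    (β : (Fin n → Bool) → (Fin n → Bool) → (Fin n → X N) → ℂ) (Ψ : A.State N W) :
    applyLocal (A.dataLocal X T x₀ N K) (joint ζ β fun _ => Ψ) =
      joint ζ (fun x y => piMat (fun _ => K.1) *ᵥ β x y) fun _ => Ψ := by
  funext c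
  refine (piMat_controlled_mulVec _ _ _ _).trans ?_
  simp only [mulVec, dotProduct, joint]
  by_cases hc : Silent c
  · rw [if_pos hc, Finset.sum_mul]
    refine Finset.sum_congr rfl fun p _ => ?_
    rw [mul_assoc]
    congr 1
    exact if_pos hc
  · rw [if_neg hc]
    refine Finset.sum_eq_zero fun p _ => ?_
    refine mul_eq_zero_of_right _ (if_neg hc)

theorem applyLocal_instLocal (u : A.Local N)
    (β : (Fin n → Bool) → (Fin n → Bool) → (Fin n → X N) → ℂ)
    (Ψ : (Fin n → Bool) → A.State N W) :
    applyLocal (A.instLocal X T x₀ N u) (joint ζ β Ψ) =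
      joint ζ β fun z => applyLocal u (Ψ z) := by
  funext c
  refine (piMat_controlled_mulVec _ _ _ _).trans ?_
  simp only [joint]
  by_cases hc : Silent c
  · rw [if_pos hc]
    have h := congrFun (piMat_swap_mulVec (fun v (_ : T N) => (u (W.deg v)).1)
      fun t => Ψ (query ζ t (inputs c) (dat c))) fun v => (c v).2.2.1.2
    refine Eq.trans ?_ (congrArg (fun a => β (inputs c) (outputs c) (dat c) * a) h)
    simp only [mulVec, dotProduct]
    rw [Finset.mul_sum]
    refine Finset.sum_congr rfl fun p _ => ?_
    rw [mul_left_comm]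
    congr 1
    exact if_pos hc
  · rw [if_neg hc]
    refine Finset.sum_eq_zero fun p _ => ?_
    refine mul_eq_zero_of_right _ (if_neg hc)

theorem applyLocal_loadLocal (ψ : (A.host X T x₀).State N W) :
    applyLocal (A.loadLocal x₀ ζ) ψ = fun c => ψ fun v => loadConf ζ (c v) :=
  piMat_permUnitary_mulVec _ _ _

theorem applyLocal_answerLocal {π : (T N → Bool) → Bool × X N → Bool × X N}
    (hπ : ∀ h, Function.Involutive (π h)) (ψ : (A.host X T x₀).State N W) :
    applyLocal (A.answerLocal x₀ hπ) ψ = fun c => ψ fun v => answerConf π (c v) :=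
  piMat_permUnitary_mulVec _ _ _

/-- Adds bits to the input registers. -/
def addInputs (z : Fin n → Bool) (c : A.GConf N W) : A.GConf N W :=
  fun v => (xor (z v) (c v).1, (c v).2)

theorem joint_load (β : (Fin n → Bool) → (Fin n → Bool) → (Fin n → X N) → ℂ)
    (Ψ : (Fin n → Bool) → A.State N W) :
    applyLocal (A.loadLocal x₀ ζ) (joint ζ β Ψ) = joint ζ β fun z κ => Ψ z (addInputs z κ) := by
  rw [applyLocal_loadLocal]
  rfl

/-- On the support, the outputs of a copy are the same at all parties and determined by its query,
so all parties apply the same `π`. By `hζ` the queries survive the change of data, and the states of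
the copies stay correct. -/
theorem joint_answer {π : (T N → Bool) → Bool × X N → Bool × X N}
    (hπ : ∀ h, Function.Involutive (π h))
    (hζ : ∀ t x h p, ζ t x (π h p).2 = ζ t x p.2)
    (β : (Fin n → Bool) → (Fin n → Bool) → (Fin n → X N) → ℂ)
    (Ψ : (Fin n → Bool) → A.State N W) (f : (Fin n → Bool) → Bool)
    (hΨ : ∀ z κ, Ψ z κ ≠ 0 → ∀ v, outputs κ v = f z) :
    applyLocal (A.answerLocal x₀ hπ) (joint ζ β Ψ) =
      joint ζ (fun x y χ => β x
        (fun v => (π (fun t => f (query ζ t x χ)) (y v, χ v)).1)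
        (fun v => (π (fun t => f (query ζ t x χ)) (y v, χ v)).2)) Ψ := by
  rw [applyLocal_answerLocal]
  funext c
  simp only [joint]
  by_cases hc : Silent c
  · rw [if_pos hc]
    refine (if_pos hc).trans ?_
    have hq : ∀ t, query ζ t (inputs c)
        (dat (x₀ := x₀) fun v => (answerConf π (c v) : HostConf A X T N (W.deg v))) =
        query ζ t (inputs c) (dat c) := fun t => funext fun v => hζ _ _ _ _
    have h1 : ∀ t, Ψ (query ζ t (inputs c)
        (dat (x₀ := x₀) fun v => (answerConf π (c v) : HostConf A X T N (W.deg v)))) (inst c t) =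
        Ψ (query ζ t (inputs c) (dat c)) (inst c t) := fun t => by rw [hq]
    by_cases h0 : ∏ t, Ψ (query ζ t (inputs c) (dat c)) (inst c t) = 0
    · rw [h0, mul_zero]
      refine mul_eq_zero_of_right _ ?_
      rw [← h0]
      exact Finset.prod_congr rfl fun t _ => h1 t
    · have hans : ∀ v t, (inst c t v).2.1 = f (query ζ t (inputs c) (dat c)) :=
        fun v t => hΨ _ _ (Finset.prod_ne_zero_iff.1 h0 t (Finset.mem_univ t)) v
      have hπv : ∀ v, π (fun t => (inst c t v).2.1) (outputs c v, dat c v) =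
          π (fun t => f (query ζ t (inputs c) (dat c))) (outputs c v, dat c v) := by
        intro v
        congr 1
        exact funext (hans v)
      refine congr (congrArg HMul.hMul ?_) (Finset.prod_congr rfl fun t _ => h1 t)
      exact congr (congrArg (β _) (funext fun v => congrArg Prod.fst (hπv v)))
        (funext fun v => congrArg Prod.snd (hπv v))
  · rw [if_neg hc]
    exact if_neg hc

/-- Delivery of the messages of all copies. -/
def deliverAll (c : (A.host X T x₀).GConf N W) : (A.host X T x₀).GConf N W :=
  fun v => ((c v).1, (c v).2.1, ((c v).2.2.1.1, fun t => deliver (inst c t) v), (c v).2.2.2)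

/-- `packConf` at all parties. -/
def packAll (c : (A.host X T x₀).GConf N W) : (A.host X T x₀).GConf N W :=
  fun v => packConf (A := A) (X := X) (T := T) (c v)

theorem applyLocal_packLocal (ψ : (A.host X T x₀).State N W) :
    applyLocal (A.packLocal x₀) ψ = fun c => ψ (packAll c) :=
  piMat_permUnitary_mulVec _ _ _

theorem packAll_involutive :
    Function.Involutive (packAll : (A.host X T x₀).GConf N W → _) :=
  fun c => funext fun v => packConf_involutive A (W.deg v) (c v)

theorem transfer_pack_of_silent {c : (A.host X T x₀).GConf N W} (hc : Silent c) (v : Fin n)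
    (i : Fin (W.deg v)) :
    transfer pack (fun _ => Word.empty _)
      ((fun t => msg (inst c t) v i), (msg c v i : Word (packLen (T N) (A.maxLen N)))) =
      ((fun _ => Word.empty _), pack fun t => msg (inst c t) v i) := by
  rw [hc v i, ← pack_empty, transfer_right]

theorem msg_packAll {c : (A.host X T x₀).GConf N W} (hc : Silent c) (v : Fin n)
    (i : Fin (W.deg v)) : msg (packAll c) v i = pack fun t => msg (inst c t) v i :=
  congrArg Prod.snd (transfer_pack_of_silent hc v i)

theorem msg_inst_packAll {c : (A.host X T x₀).GConf N W} (hc : Silent c) (t : T N) (v : Fin n)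
    (i : Fin (W.deg v)) : msg (inst (packAll c) t) v i = Word.empty _ :=
  congrFun (congrArg Prod.fst (transfer_pack_of_silent hc v i)) t

/-- The first packing empties the copies' message registers, the exchange moves the codes along the
links, and the second packing decodes them into the emptied registers. -/
theorem pack_deliver_pack {c : (A.host X T x₀).GConf N W} (hc : Silent c) :
    packAll (deliver (packAll c)) = deliverAll c := by
  have key : ∀ v i, transfer pack (fun _ => Word.empty _)
      ((fun t => msg (inst (packAll c) t) v i),
        (msg (packAll c) (W.nbr v i) (W.opp v i) : Word (packLen (T N) (A.maxLen N)))) =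
      ((fun t => msg (deliver (inst c t)) v i),
        (msg c v i : Word (packLen (T N) (A.maxLen N)))) := by
    intro v i
    simp only [msg_inst_packAll hc]
    rw [msg_packAll hc, transfer_left pack_injective, hc v i, pack_empty]
    rfl
  funext v
  refine Prod.ext rfl (Prod.ext rfl (Prod.ext (Prod.ext rfl (funext fun t => ?_))
    (funext fun i => congrArg Prod.snd (key v i))))
  exact Prod.ext rfl (Prod.ext rfl (Prod.ext rfl
    (funext fun i => congrFun (congrArg Prod.fst (key v i)) t)))

variable (A X T x₀ N) in
/-- The circuit that exchanges the messages of all copies. -/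
def exchangeAll : (A.host X T x₀).Circuit N := [some (A.packLocal x₀), none, some (A.packLocal x₀)]

theorem silent_deliverAll (c : (A.host X T x₀).GConf N W) : Silent (deliverAll c) ↔ Silent c :=
  Iff.rfl

theorem joint_deliverAll (β : (Fin n → Bool) → (Fin n → Bool) → (Fin n → X N) → ℂ)
    (Ψ : (Fin n → Bool) → A.State N W) (c : (A.host X T x₀).GConf N W) :
    joint ζ β Ψ (deliverAll c) = joint ζ β (fun z => A.exchange N W (Ψ z)) c := rfl

theorem joint_of_not_silent (β : (Fin n → Bool) → (Fin n → Bool) → (Fin n → X N) → ℂ)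
    (Ψ : (Fin n → Bool) → A.State N W) {c : (A.host X T x₀).GConf N W} (hc : ¬ Silent c) :
    joint ζ β Ψ c = 0 := if_neg hc

/-- Pack, deliver, pack is an involution that preserves silence, so no configuration that is not
silent is sent to a silent one. -/
theorem silent_of_silent_pack {c : (A.host X T x₀).GConf N W}
    (hs : Silent (packAll (deliver (packAll c)))) : Silent c := by
  have h := pack_deliver_pack hs
  rw [packAll_involutive, deliver_involutive, packAll_involutive] at h
  rwa [← silent_deliverAll, ← h] at hs

theorem run_exchangeAll (β : (Fin n → Bool) → (Fin n → Bool) → (Fin n → X N) → ℂ)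
    (Ψ : (Fin n → Bool) → A.State N W) :
    run (exchangeAll A X T x₀ N) (joint ζ β Ψ) =
      joint ζ β fun z => A.exchange N W (Ψ z) := by
  simp only [exchangeAll, run, applyLocal_packLocal, exchange]
  funext c
  by_cases hc : Silent c
  · rw [pack_deliver_pack hc, joint_deliverAll]
  · rw [joint_of_not_silent ζ β _ hc,
      joint_of_not_silent ζ β _ fun hs => hc (silent_of_silent_pack hs)]

/-- The copies may handle different queries in superposition, hence the supremum over `z` for each
link separately; packing contributes the factor `3 * card T`. -/
theorem cost_exchangeAll (β : (Fin n → Bool) → (Fin n → Bool) → (Fin n → X N) → ℂ)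
    (Ψ : (Fin n → Bool) → A.State N W) :
    cost (exchangeAll A X T x₀ N) (joint ζ β Ψ) ≤
      3 * (Fintype.card (T N) : ℕ∞) * ∑ v, ∑ i, ⨆ z, sentThrough (Ψ z) v i := by
  simp only [exchangeAll, cost, add_zero, Finset.mul_sum, applyLocal_packLocal]
  refine Finset.sum_le_sum fun v _ => Finset.sum_le_sum fun i _ => sentThrough_le fun c hc => ?_
  have hc' : joint ζ β Ψ (packAll c) ≠ 0 := hc
  obtain ⟨c', rfl⟩ := packAll_involutive.surjective c
  rw [packAll_involutive] at hc'
  simp only [joint] at hc'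
  split_ifs at hc' with hs
  · rw [msg_packAll hs]
    have hsupp := Finset.prod_ne_zero_iff.1 (right_ne_zero_of_mul hc')
    obtain ⟨m, hm⟩ | hm := (em (∃ m : ℕ, (⨆ z, sentThrough (Ψ z) v i) = m))
    · rw [hm]
      have : (pack fun t => msg (inst c' t) v i).length ≤ 3 * Fintype.card (T N) * m := by
        refine pack_length_le fun t => ?_
        have h1 := le_sentThrough v i (hsupp t (Finset.mem_univ t))
        have h2 := h1.trans (le_iSup (fun z => sentThrough (Ψ z) v i) _)
        rw [hm] at h2
        exact_mod_cast h2
      exact_mod_cast this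
    · have htop : (⨆ z, sentThrough (Ψ z) v i) = ⊤ := by
        by_contra hne
        obtain ⟨m, hm'⟩ := ENat.ne_top_iff_exists.1 hne
        exact hm ⟨m, hm'.symm⟩
      rw [htop]
      -- Here `0 * ⊤ = 0`, so without copies the message itself must be shown to be empty.
      by_cases hT : Fintype.card (T N) = 0
      · have : (pack fun t => msg (inst c' t) v i).length ≤ 3 * Fintype.card (T N) * 0 := by
          have := Fintype.card_eq_zero_iff.1 hT
          exact pack_length_le fun t => isEmptyElim t
        have h0 : (pack fun t => msg (inst c' t) v i).length = 0 := by simpa using this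
        rw [h0]
        simp
      · rw [ENat.mul_top]
        · exact le_top
        · simp [hT]
  · exact absurd rfl hc'

end Host

end Algorithm

namespace Algorithm

/-! ### Classical traffic bounded by the traffic of one generic quantum input. -/

section Superposition

variable (A : Algorithm) (N : ℕ) {n : ℕ} (W : Network n)

/-- State of the algorithm before an exchange, for a classical input. -/
def basisState (r : ℕ) (z : Fin n → Bool) : A.State N W := A.stateAt N W (Pi.single z 1) r

theorem stateAt_eq_sum (α : (Fin n → Bool) → ℂ) (r : ℕ) (c : A.GConf N W) :
    A.stateAt N W α r c = ∑ z, α z * A.basisState N W r z c := by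
  have hstep : ∀ (r : ℕ) (φ : (Fin n → Bool) → A.State N W) (c : A.GConf N W),
      A.localStep N W r (fun c => ∑ z, α z * φ z c) c =
        ∑ z, α z * A.localStep N W r (φ z) c := by
    intro r φ c
    simp only [localStep, Finset.mul_sum]
    rw [Finset.sum_comm]
    refine Finset.sum_congr rfl fun z _ => Finset.sum_congr rfl fun c' _ => ?_
    ring
  induction r generalizing c with
  | zero =>
    have h : A.initState N W α = fun c => ∑ z, α z * A.initState N W (Pi.single z 1) c := by
      funext c
      simp only [initState, distributed]
      split_ifs
      · rw [Finset.sum_eq_single (inputs c)]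
        · simp
        · intro z _ hz
          simp [hz.symm]
        · simp
      · simp
    simp only [basisState, stateAt]
    rw [h, hstep]
  | succ r ih =>
    have h : A.exchange N W (A.stateAt N W α r) =
        fun c => ∑ z, α z * A.exchange N W (A.basisState N W r z) c :=
      funext fun c => ih _
    rw [stateAt, h, hstep]
    rfl

/-- A classical input. -/
def basisInput (z : Fin n → Bool) : Input n :=
  ⟨Pi.single z 1, by
    rw [Finset.sum_eq_single z]
    · simp
    · intro x _ hx
      simp [hx]
    · simp⟩

/-- Each amplitude is a linear functional of the input. Finitely many nonzero functionals have a
common point of nonvanishing, and rescaling it to norm one keeps it nonvanishing. -/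
theorem exists_input_basisState_ne_zero :
    ∃ α : Input n, ∀ r < A.rounds N, ∀ z c, A.basisState N W r z c ≠ 0 →
      A.stateAt N W α.1 r c ≠ 0 := by
  -- The additional index `none` stands for a coordinate functional; it ensures `α ≠ 0`, so that `α`
  -- can be normalized.
  let ι := Option {p : Fin (A.rounds N) × A.GConf N W // ∃ z, A.basisState N W p.1 z p.2 ≠ 0}
  let f : ι → Module.Dual ℂ ((Fin n → Bool) → ℂ) := fun i =>
    i.elim (LinearMap.proj fun _ => false) fun p =>
      Fintype.linearCombination ℂ fun z => A.basisState N W p.1.1 z p.1.2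
  obtain ⟨α, hα⟩ := Module.Dual.exists_forall_ne_zero_of_forall_exists f (by
    rintro (_ | ⟨⟨r, c⟩, z, hz⟩)
    · exact ⟨fun _ => 1, one_ne_zero⟩
    · refine ⟨Pi.single z 1, ?_⟩
      simpa [f, Fintype.linearCombination_apply, Pi.single_apply] using hz)
  have hα0 : α (fun _ => false) ≠ 0 := hα none
  set s : ℝ := ∑ x, ‖α x‖ ^ 2 with hs
  have hpos : 0 < s := by
    refine Finset.sum_pos' (fun x _ => by positivity) ⟨_, Finset.mem_univ (fun _ => false), ?_⟩
    have := norm_pos_iff.2 hα0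
    positivity
  have hsq : 0 < Real.sqrt s := Real.sqrt_pos.2 hpos
  refine ⟨⟨fun x => ((Real.sqrt s)⁻¹ : ℝ) * α x, ?_⟩, ?_⟩
  · simp only [norm_mul, mul_pow, ← Finset.mul_sum, ← hs, Complex.norm_real, Real.norm_eq_abs,
      sq_abs, inv_pow, Real.sq_sqrt hpos.le]
    exact inv_mul_cancel₀ hpos.ne'
  · intro r hr z c hz
    have h := hα (some ⟨(⟨r, hr⟩, c), z, hz⟩)
    simp only [f, Option.elim, Fintype.linearCombination_apply, smul_eq_mul] at h
    rw [stateAt_eq_sum]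
    simp only [mul_assoc, ← Finset.mul_sum]
    refine mul_ne_zero ?_ h
    exact_mod_cast (inv_pos.2 hsq).ne'

/-- Number of bits sent before an exchange, for the worst classical input for each link. -/
def classicalTraffic (r : ℕ) : ℕ∞ := ∑ v, ∑ i, ⨆ z, sentThrough (A.basisState N W r z) v i

theorem sum_classicalTraffic_le :
    ∑ r ∈ Finset.range (A.rounds N), A.classicalTraffic N W r ≤ A.bitComplexity N W := by
  obtain ⟨α, hα⟩ := A.exists_input_basisState_ne_zero N W
  refine le_trans ?_ (le_iSup (fun α : Input n => ∑ r ∈ Finset.range (A.rounds N), ∑ v, ∑ i,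
    A.bitsSent N W α.1 r v i) α)
  refine Finset.sum_le_sum fun r hr => Finset.sum_le_sum fun v _ => Finset.sum_le_sum fun i _ => ?_
  refine iSup_le fun z => sentThrough_le fun c hc => ?_
  exact le_sentThrough v i (hα r (Finset.mem_range.1 hr) z c hc)

end Superposition

/-! ### Compute, use the answers, uncompute. -/

section Block

set_option synthInstance.maxSize 2000
set_option linter.unusedSectionVars false

variable (A : Algorithm) {X T : ℕ → Type} [∀ N, Fintype (X N)] [∀ N, DecidableEq (X N)]
  [∀ N, Fintype (T N)] [∀ N, DecidableEq (T N)] (x₀ : ∀ N, X N) {N : ℕ}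
  (ζ : T N → Bool → X N → Bool)

/-- The first `r` rounds of `A`, performed by all copies. -/
def forward : ℕ → (A.host X T x₀).Circuit N
  | 0 => [some (A.instLocal X T x₀ N fun d => A.op N d 0)]
  | r + 1 => forward r ++
    (exchangeAll A X T x₀ N ++ [some (A.instLocal X T x₀ N fun d => A.op N d (r + 1))])

/-- The inverse of the first `r` rounds of `A`, performed by all copies. -/
def backward : ℕ → (A.host X T x₀).Circuit N
  | 0 => [some (A.instLocal X T x₀ N fun d => (A.op N d 0)⁻¹)]
  | r + 1 => [some (A.instLocal X T x₀ N fun d => (A.op N d (r + 1))⁻¹)] ++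
    (exchangeAll A X T x₀ N ++ backward r)

/-- The circuit that changes output and data register depending on the values computed by the
copies of `A` on given queries. -/
def block {π : (T N → Bool) → Bool × X N → Bool × X N}
    (hπ : ∀ h, Function.Involutive (π h)) : (A.host X T x₀).Circuit N :=
  [some (A.loadLocal x₀ ζ)] ++ (A.forward x₀ (A.rounds N) ++ ([some (A.answerLocal x₀ hπ)] ++
    (A.backward x₀ (A.rounds N) ++ [some (A.loadLocal x₀ ζ)])))

theorem exchanges_exchangeAll : exchanges (exchangeAll A X T x₀ N) = 1 := rfl

theorem exchanges_some (u : (A.host X T x₀).Local N) : exchanges [some u] = 0 := rfl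

theorem exchanges_forward (r : ℕ) : exchanges (A.forward x₀ (T := T) (N := N) r) = r := by
  induction r with
  | zero => rfl
  | succ r ih =>
    simp only [forward, exchanges_append, ih, exchanges_exchangeAll, exchanges_some]

theorem exchanges_backward (r : ℕ) : exchanges (A.backward x₀ (T := T) (N := N) r) = r := by
  induction r with
  | zero => rfl
  | succ r ih =>
    simp only [backward, exchanges_append, ih, exchanges_exchangeAll, exchanges_some]
    omega

theorem exchanges_block {π : (T N → Bool) → Bool × X N → Bool × X N}
    (hπ : ∀ h, Function.Involutive (π h)) :
    exchanges (A.block x₀ ζ hπ) = 2 * A.rounds N := by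
  simp only [block, exchanges_append, exchanges_forward, exchanges_backward, exchanges_some]
  omega

variable {A x₀} {n : ℕ} {W : Network n}
  (β : (Fin n → Bool) → (Fin n → Bool) → (Fin n → X N) → ℂ)

theorem run_some (u : A.Local N) (ψ : A.State N W) : run [some u] ψ = applyLocal u ψ := rfl

theorem cost_some (u : A.Local N) (ψ : A.State N W) : cost [some u] ψ = 0 := rfl

/-- Initial state for a classical input. -/
def basisInit (A : Algorithm) (N : ℕ) (W : Network n) (z : Fin n → Bool) : A.State N W :=
  A.initState N W (Pi.single z 1)

theorem run_forward (r : ℕ) :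
    run (A.forward x₀ r) (joint ζ β (A.basisInit N W)) =
      (joint ζ β (A.basisState N W r) : (A.host X T x₀).State N W) := by
  induction r with
  | zero =>
    rw [forward, run_some, applyLocal_instLocal]
    rfl
  | succ r ih =>
    rw [forward, run_append, run_append, ih, run_exchangeAll, run_some, applyLocal_instLocal]
    rfl

theorem basisState_succ (r : ℕ) (z : Fin n → Bool) :
    A.basisState N W (r + 1) z =
      applyLocal (fun d => A.op N d (r + 1)) (A.exchange N W (A.basisState N W r z)) := rfl

theorem run_inv_basisState_succ (r : ℕ) :
    run [some (A.instLocal X T x₀ N fun d => (A.op N d (r + 1))⁻¹)]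
        (joint ζ β (A.basisState N W (r + 1))) =
      joint ζ β fun z => A.exchange N W (A.basisState N W r z) := by
  rw [run_some, applyLocal_instLocal]
  simp only [basisState_succ, applyLocal_inv]

theorem run_backward (r : ℕ) :
    run (A.backward x₀ r) (joint ζ β (A.basisState N W r)) =
      (joint ζ β (A.basisInit N W) : (A.host X T x₀).State N W) := by
  induction r with
  | zero =>
    rw [backward, run_some, applyLocal_instLocal]
    exact congrArg (joint ζ β) (funext fun z => applyLocal_inv _ _)
  | succ r ih =>
    rw [backward, run_append, run_append, run_inv_basisState_succ, run_exchangeAll]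
    simp only [exchange_exchange]
    exact ih

theorem cost_forward (r : ℕ) :
    cost (A.forward x₀ r)
        (joint ζ β (A.basisInit N W) : (A.host X T x₀).State N W) ≤
      3 * (Fintype.card (T N) : ℕ∞) * ∑ s ∈ Finset.range r, A.classicalTraffic N W s := by
  induction r with
  | zero => simp [forward, cost_some]
  | succ r ih =>
    rw [forward, cost_append, cost_append, run_forward, cost_some, add_zero,
      Finset.sum_range_succ, mul_add]
    exact add_le_add ih (cost_exchangeAll ζ β _)

theorem sentThrough_exchange_le (ψ : A.State N W) (v : Fin n) (i : Fin (W.deg v)) :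
    sentThrough (A.exchange N W ψ) v i ≤ sentThrough ψ (W.nbr v i) (W.opp v i) := by
  refine sentThrough_le fun c hc => ?_
  have h := le_sentThrough (ψ := ψ) (W.nbr v i) (W.opp v i) (c := deliver c) hc
  have h2 : msg (deliver (deliver c)) v i = msg c v i := by rw [deliver_involutive]
  rw [← h2]
  exact h

/-- Undoing a round sends its messages back along the reversed links, so the total over both
directions is bounded by the same traffic. -/
theorem cost_backward (r : ℕ) :
    cost (A.backward x₀ r)
        (joint ζ β (A.basisState N W r) : (A.host X T x₀).State N W) ≤
      3 * (Fintype.card (T N) : ℕ∞) * ∑ s ∈ Finset.range r, A.classicalTraffic N W s := by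
  induction r with
  | zero => simp [backward, cost_some]
  | succ r ih =>
    rw [backward, cost_append, cost_append, run_inv_basisState_succ, run_exchangeAll, cost_some,
      zero_add, Finset.sum_range_succ, mul_add, add_comm]
    simp only [exchange_exchange]
    refine add_le_add ih ((cost_exchangeAll ζ β _).trans (mul_le_mul_right ?_ _))
    rw [classicalTraffic, ← W.sum_reverse fun v i => ⨆ z, sentThrough (A.basisState N W r z) v i]
    exact Finset.sum_le_sum fun v _ => Finset.sum_le_sum fun i _ =>
      iSup_mono fun z => sentThrough_exchange_le _ v i

theorem initState_addInputs (z : Fin n → Bool) (κ : A.GConf N W) :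
    A.basisInit N W (fun _ => false) (addInputs z κ) = A.basisInit N W z κ := by
  have h : inputs (addInputs z κ) = (fun _ => false) ↔ inputs κ = z := by
    rw [funext_iff, funext_iff]
    refine forall_congr' fun v => ?_
    simp only [inputs, addInputs]
    generalize z v = a, (κ v).1 = b
    revert a b
    decide
  simp only [basisInit, initState, distributed, Pi.single_apply, h]
  rfl

theorem load_clean :
    applyLocal (A.loadLocal x₀ ζ) (joint ζ β fun _ => A.basisInit N W fun _ => false) =
      (joint ζ β (A.basisInit N W) : (A.host X T x₀).State N W) := by
  rw [joint_load]
  simp only [initState_addInputs]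

theorem load_basisInit :
    applyLocal (A.loadLocal x₀ ζ) (joint ζ β (A.basisInit N W)) =
      (joint ζ β (fun _ => A.basisInit N W fun _ => false) : (A.host X T x₀).State N W) := by
  rw [joint_load]
  refine congrArg (joint ζ β) (funext fun z => funext fun κ => ?_)
  rw [← initState_addInputs]
  congr 1
  funext v
  exact Prod.ext (by simp [addInputs]) rfl

/-- The effect of `block` on the amplitudes of the input, output and data registers. -/
def answered (π : (T N → Bool) → Bool × X N → Bool × X N) (f : (Fin n → Bool) → Bool) :
    (Fin n → Bool) → (Fin n → Bool) → (Fin n → X N) → ℂ :=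
  fun x y χ => β x
    (fun v => (π (fun t => f (query ζ t x χ)) (y v, χ v)).1)
    (fun v => (π (fun t => f (query ζ t x χ)) (y v, χ v)).2)

theorem outputs_eq_of_basisState_ne_zero {f : (Fin n → Bool) → Bool}
    (hA : A.ExactlyComputes N W f) (z : Fin n → Bool) (κ : A.GConf N W)
    (h : A.basisState N W (A.rounds N) z κ ≠ 0) (v : Fin n) : outputs κ v = f z := by
  obtain ⟨g, hg⟩ := hA
  have h1 : A.basisState N W (A.rounds N) z = A.distributed N W (Pi.single z 1) f g :=
    hg (basisInput z)
  rw [h1, distributed] at h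
  split_ifs at h with hy
  · have hz : inputs κ = z := by
      by_contra hne
      simp [hne] at h
    rw [← hz]
    exact hy v
  · exact absurd rfl h

/-- The answers are classical functions of the queries, so using them leaves the states of the
copies intact, and the inverse run restores them together with their garbage. -/
theorem run_block
    {π : (T N → Bool) → Bool × X N → Bool × X N} (hπ : ∀ h, Function.Involutive (π h))
    (hζ : ∀ t x h p, ζ t x (π h p).2 = ζ t x p.2) {f : (Fin n → Bool) → Bool}
    (hA : A.ExactlyComputes N W f) :
    run (A.block x₀ ζ hπ) (joint ζ β fun _ => A.basisInit N W fun _ => false) =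
      (joint ζ (answered ζ β π f) fun _ => A.basisInit N W fun _ => false) := by
  rw [block, run_append, run_append, run_append, run_append, run_some, run_some, run_some,
    load_clean, run_forward,
    joint_answer ζ hπ hζ β _ f (outputs_eq_of_basisState_ne_zero hA), run_backward,
    load_basisInit]
  rfl

theorem cost_block
    {π : (T N → Bool) → Bool × X N → Bool × X N} (hπ : ∀ h, Function.Involutive (π h))
    (hζ : ∀ t x h p, ζ t x (π h p).2 = ζ t x p.2) {f : (Fin n → Bool) → Bool}
    (hA : A.ExactlyComputes N W f) :
    cost (A.block x₀ ζ hπ) (joint ζ β fun _ => A.basisInit N W fun _ => false) ≤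
      6 * (Fintype.card (T N) : ℕ∞) * A.bitComplexity N W := by
  rw [block, cost_append, cost_append, cost_append, cost_append, run_some, run_some,
    load_clean, run_forward,
    joint_answer ζ hπ hζ β _ f (outputs_eq_of_basisState_ne_zero hA), cost_some, cost_some,
    cost_some, zero_add, zero_add, add_zero]
  refine (add_le_add (cost_forward ζ _ _) (cost_backward ζ _ _)).trans ?_
  rw [← two_mul, ← mul_assoc, ← mul_assoc]
  exact mul_le_mul' (by norm_num) (sum_classicalTraffic_le A N W)

end Block

end Algorithm

/-! ### Matrices that destroy agreement. -/

section Unitaries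

open Matrix

/-- The two columns are unit vectors because the weights sum to one, and orthogonal because the
weighted mean of `η` is zero; any orthonormal completion serves. -/
theorem exists_unitary_of_weights (p : Fin 3 → ℝ) (η : Fin 3 → ℂ) (hp : ∀ i, 0 ≤ p i)
    (hsum : ∑ i, p i = 1) (hη : ∀ i, ‖η i‖ = 1) (hpη : ∑ i, (p i : ℂ) * η i = 0) :
    ∃ U : unitaryGroup (Fin 3) ℂ, ∀ i, U.1 i 0 = (Real.sqrt (p i) : ℂ) ∧
      U.1 i 1 = (Real.sqrt (p i) : ℂ) * η i := by
  have hsq : ∀ i, (Real.sqrt (p i) : ℂ) * (Real.sqrt (p i) : ℂ) = p i := fun i => by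
    rw [← Complex.ofReal_mul, Real.mul_self_sqrt (hp i)]
  have hηη : ∀ i, η i * (starRingEnd ℂ) (η i) = 1 := fun i => by
    rw [Complex.mul_conj, Complex.normSq_eq_norm_sq, hη]
    simp
  have hsumC : ∑ i, (p i : ℂ) = 1 := by exact_mod_cast hsum
  let a : EuclideanSpace ℂ (Fin 3) := WithLp.toLp 2 fun i => (Real.sqrt (p i) : ℂ)
  let b : EuclideanSpace ℂ (Fin 3) := WithLp.toLp 2 fun i => (Real.sqrt (p i) : ℂ) * η i
  have haa : inner ℂ a a = (1 : ℂ) := by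
    rw [← hsumC, PiLp.inner_apply]
    refine Finset.sum_congr rfl fun i _ => ?_
    rw [← hsq, RCLike.inner_apply]
    change _ * (starRingEnd ℂ) _ = _
    rw [Complex.conj_ofReal]
  have hbb : inner ℂ b b = (1 : ℂ) := by
    rw [← hsumC, PiLp.inner_apply]
    refine Finset.sum_congr rfl fun i _ => ?_
    rw [← hsq, ← mul_one ((Real.sqrt (p i) : ℂ) * (Real.sqrt (p i) : ℂ)), ← hηη i,
      RCLike.inner_apply]
    change _ * (starRingEnd ℂ) (_ * _) = _
    rw [map_mul, Complex.conj_ofReal]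
    ring
  have hab : inner ℂ a b = (0 : ℂ) := by
    rw [← hpη, PiLp.inner_apply]
    refine Finset.sum_congr rfl fun i _ => ?_
    rw [← hsq]
    simp [a, b]
    ring
  have hba : inner ℂ b a = (0 : ℂ) := inner_eq_zero_symm.1 hab
  have key : ∀ i ∈ ({0, 1} : Set (Fin 3)), ∀ j ∈ ({0, 1} : Set (Fin 3)),
      inner ℂ (![a, b, 0] i) (![a, b, 0] j) = if i = j then (1 : ℂ) else 0 := by
    rintro i (rfl | rfl) j (rfl | rfl)
    · exact haa
    · exact hab
    · exact hba
    · exact hbb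
  have hv : Orthonormal ℂ (({0, 1} : Set (Fin 3)).domRestrict ![a, b, 0]) := by
    rw [orthonormal_iff_ite]
    intro i j
    simp only [Subtype.ext_iff]
    exact key i i.2 j j.2
  obtain ⟨B, hB⟩ := hv.exists_orthonormalBasis_extension_of_card_eq (by simp)
  have h0 : B 0 = a := hB 0 (by simp)
  have h1 : B 1 = b := hB 1 (by simp)
  refine ⟨⟨Matrix.of fun i j => B j i, ?_⟩, fun i => ⟨?_, ?_⟩⟩
  · rw [mem_unitaryGroup_iff']
    ext j k
    have := orthonormal_iff_ite.1 B.orthonormal j k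
    rw [PiLp.inner_apply] at this
    rw [Matrix.mul_apply, Matrix.one_apply, ← this]
    refine Finset.sum_congr rfl fun i _ => ?_
    simp [Matrix.star_apply, mul_comm]
  · change B 0 i = _
    rw [h0]
  · change B 1 i = _
    rw [h1]

/-- For even `m`, two antipodal roots of `-1` balance. For odd `m` no roots are antipodal, but `-1`
and `exp (± π i / m)` balance, with nonnegative weights because `cos (π / m) ≥ 0`. -/
theorem exists_weights {m : ℕ} (hm : 2 ≤ m) :
    ∃ (p : Fin 3 → ℝ) (η : Fin 3 → ℂ), (∀ i, 0 ≤ p i) ∧ ∑ i, p i = 1 ∧ (∀ i, ‖η i‖ = 1) ∧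
      ∑ i, (p i : ℂ) * η i = 0 ∧ ∀ i, η i ^ m = -1 := by
  set θ : ℝ := Real.pi / m with hθ
  have hm0 : (m : ℝ) ≠ 0 := by positivity
  have hmθ : (m : ℂ) * (θ * Complex.I) = Real.pi * Complex.I := by
    rw [← mul_assoc, hθ]
    push_cast
    rw [mul_div_cancel₀]
    exact_mod_cast hm0
  have he : Complex.exp (θ * Complex.I) ^ m = -1 := by
    rw [← Complex.exp_nat_mul, hmθ, Complex.exp_pi_mul_I]
  have he' : Complex.exp (-(θ * Complex.I)) ^ m = -1 := by
    rw [Complex.exp_neg, inv_pow, he]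
    norm_num
  have hn : ‖Complex.exp (θ * Complex.I)‖ = 1 := Complex.norm_exp_ofReal_mul_I θ
  have hn' : ‖Complex.exp (-(θ * Complex.I))‖ = 1 := by
    rw [Complex.exp_neg, norm_inv, hn, inv_one]
  rcases Nat.even_or_odd m with hev | hodd
  · refine ⟨![1 / 2, 1 / 2, 0],
      ![Complex.exp (θ * Complex.I), -Complex.exp (θ * Complex.I), Complex.exp (θ * Complex.I)],
      ?_, ?_, ?_, ?_, ?_⟩
    · intro i
      fin_cases i <;> simp
    · simp [Fin.sum_univ_three]
      norm_num
    · intro i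
      fin_cases i <;> simp [hn]
    · simp [Fin.sum_univ_three]
    · intro i
      fin_cases i
      · exact he
      · exact hev.neg_pow _ |>.trans he
      · exact he
  · have hcos : 0 ≤ Real.cos θ := by
      refine Real.cos_nonneg_of_mem_Icc ⟨?_, ?_⟩
      · have : 0 ≤ θ := by positivity
        linarith [Real.pi_pos]
      · rw [hθ]
        exact div_le_div_of_nonneg_left Real.pi_pos.le two_pos (by exact_mod_cast hm)
    have hd : (0 : ℝ) < 2 * Real.cos θ + 2 := by linarith
    have hE : Complex.exp (θ * Complex.I) + Complex.exp (-(θ * Complex.I)) =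
        2 * (Real.cos θ : ℂ) := by
      rw [Complex.ofReal_cos, Complex.cos]
      ring_nf
    refine ⟨![2 * Real.cos θ / (2 * Real.cos θ + 2), 1 / (2 * Real.cos θ + 2),
        1 / (2 * Real.cos θ + 2)],
      ![-1, Complex.exp (θ * Complex.I), Complex.exp (-(θ * Complex.I))], ?_, ?_, ?_, ?_, ?_⟩
    · intro i
      fin_cases i
      · exact div_nonneg (by linarith) hd.le
      · exact div_nonneg zero_le_one hd.le
      · exact div_nonneg zero_le_one hd.le
    · simp only [Fin.sum_univ_three, cons_val_zero, cons_val_one, cons_val_two, tail_cons, head_cons]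
      field_simp
      ring
    · intro i
      fin_cases i
      · simp
      · exact hn
      · exact hn'
    · have key : ∀ q c : ℂ, c / q * -1 + 1 / q * Complex.exp (θ * Complex.I) +
          1 / q * Complex.exp (-(θ * Complex.I)) = (Complex.exp (θ * Complex.I) +
            Complex.exp (-(θ * Complex.I)) - c) / q := fun q c => by ring
      simp only [Fin.sum_univ_three, cons_val_zero, cons_val_one, cons_val_two, tail_cons,
        head_cons, Complex.ofReal_div, Complex.ofReal_one, key, hE]
      push_cast
      simp
    · intro i
      fin_cases i
      · exact hodd.neg_one_pow
      · exact he
      · exact he'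

/-- Preparing a register of each of `m ≥ 2` parties with `P`, projecting onto equal contents, and
then applying `U` to each register leads to contents that are not all equal. -/
theorem exists_desynchronizing {m : ℕ} (hm : 2 ≤ m) :
    ∃ P U : unitaryGroup (Fin 3) ℂ, ∀ i, ∑ j, (U.1 i j * P.1 j 0) ^ m = 0 := by
  obtain ⟨p, η, hp, hsum, hη, hpη, hηm⟩ := exists_weights hm
  obtain ⟨U, hU⟩ := exists_unitary_of_weights p η hp hsum hη hpη
  obtain ⟨P, hP⟩ := exists_unitary_of_weights ![1 / 2, 1 / 2, 0] ![1, -1, 1]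
    (by intro i; fin_cases i <;> simp) (by simp [Fin.sum_univ_three]; norm_num)
    (by intro i; fin_cases i <;> simp) (by simp [Fin.sum_univ_three])
  refine ⟨P, U, fun i => ?_⟩
  have h2 : P.1 2 0 = 0 := by simp [(hP 2).1]
  have h01 : P.1 1 0 = P.1 0 0 := by simp [(hP 1).1, (hP 0).1]
  -- The sum is `(√(p i) * P 0 0) ^ m * (1 + η i ^ m)`, and `η i ^ m = -1`.
  rw [Fin.sum_univ_three, h2, h01, (hU i).1, (hU i).2, mul_zero, zero_pow (by omega), mul_pow,
    mul_pow, mul_pow, hηm]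
  ring

end Unitaries

/-! ### A single test: prepare, flag, rotate. -/

section Desynchronization

open Matrix

variable {n : ℕ}

/-- All parties in `x` hold the same value. -/
def Agree (x : Fin n → Bool) (a : Fin n → Fin 3) : Prop := ∃ i, ∀ v, x v = true → a v = i

/-- The initial state of the registers of a test. -/
def blank (b : Fin n → Fin 3 × Bool) : ℂ := ∏ v, if b v = (0, false) then 1 else 0

/-- Adds to all flags whether the values agree. -/
def flagged (x : Fin n → Bool) (b : Fin n → Fin 3 × Bool) : Fin n → Fin 3 × Bool :=
  open Classical in fun v => ((b v).1, xor (b v).2 (decide (Agree x fun w => (b w).1)))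

theorem flagged_involutive (x : Fin n → Bool) : Function.Involutive (flagged x) :=
  fun b => funext fun v => Prod.ext rfl (by
    change xor (xor (b v).2 _) _ = (b v).2
    rw [Bool.xor_assoc]
    exact (congrArg _ (Bool.xor_self _)).trans (Bool.xor_false _))

/-- Applies `P` to the value. -/
def prepare (P : unitaryGroup (Fin 3) ℂ) : unitaryGroup (Fin 3 × Bool) ℂ :=
  controlled (Equiv.refl _) fun _ => P

/-- Applies `U` to the value if the flag is set. -/
def desync (U : unitaryGroup (Fin 3) ℂ) : unitaryGroup (Fin 3 × Bool) ℂ :=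
  controlled (Equiv.refl _) fun s => if s then U else 1

theorem prepare_blank (P : unitaryGroup (Fin 3) ℂ) (b : Fin n → Fin 3 × Bool) :
    (piMat (fun _ => (prepare P).1) *ᵥ blank) b =
      ∏ v, if (b v).2 = false then P.1 (b v).1 0 else 0 := by
  refine (congrFun (piMat_mulVec_prod (fun _ => (prepare P).1)
    fun (_ : Fin n) (b : Fin 3 × Bool) => if b = (0, false) then 1 else 0) b).trans ?_
  refine Finset.prod_congr rfl fun v _ => ?_
  simp only [mulVec, dotProduct, mul_ite, mul_one, mul_zero]
  rw [Finset.sum_ite_eq' Finset.univ ((0 : Fin 3), false)]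
  rw [if_pos (Finset.mem_univ _)]
  exact controlledMat_apply (Equiv.refl (Fin 3 × Bool)) (fun _ => P.1) (b v) (0, false)

/-- On the support all flags record the same bit. If it is unset, the values disagreed and were left
alone; if it is set, they agreed on some `j`, and the contributions of the three `j` cancel by
`hPU`. -/
theorem desync_flagged_prepare_blank {P U : unitaryGroup (Fin 3) ℂ} {m : ℕ} (hm : m ≠ 0)
    (hPU : ∀ i, ∑ j, (U.1 i j * P.1 j 0) ^ m = 0) {x : Fin n → Bool}
    (hx : (Finset.univ.filter fun v => x v = true).card = m) {b : Fin n → Fin 3 × Bool}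
    (hb : Agree x fun v => (b v).1) :
    (piMat (fun _ => (desync U).1) *ᵥ fun b' =>
      (piMat (fun _ => (prepare P).1) *ᵥ blank) (flagged x b')) b = 0 := by
  classical
  obtain ⟨v₀, hv₀⟩ : ∃ v, x v = true := by
    have : (Finset.univ.filter fun v => x v = true).Nonempty := by
      rw [← Finset.card_pos]
      omega
    obtain ⟨v, hv⟩ := this
    exact ⟨v, by simpa using hv⟩
  simp only [prepare_blank]
  refine (piMat_controlled_mulVec (fun _ => Equiv.refl (Fin 3 × Bool))
    (fun _ s => (if s then U else 1 : unitaryGroup (Fin 3) ℂ).1) _ b).trans ?_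
  simp only [mulVec, dotProduct, flagged, Equiv.refl_apply, Equiv.refl_symm]
  by_cases hs : ∀ v, (b v).2 = true
  · obtain ⟨i, hi⟩ := hb
    let g : Fin n → Fin 3 → ℂ := fun v j => U.1 (b v).1 j * P.1 j 0
    -- Agreeing assignments are split by their common value `j`, which is unique because `v₀`
    -- belongs to `x`. Each part is a product over the parties.
    have h1 : ∀ p : Fin n → Fin 3,
        (piMat (fun v => (if (b v).2 then U else 1 : unitaryGroup (Fin 3) ℂ).1)
          (fun v => (b v).1) p *
          ∏ v, if xor (b v).2 (decide (Agree x p)) = false then P.1 (p v) 0 else 0) =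
        ∑ j, ∏ v, if x v = true → p v = j then g v (p v) else 0 := by
      intro p
      simp only [hs, if_true, piMat]
      by_cases hp : Agree x p
      · obtain ⟨j, hj⟩ := hp
        have hp' : Agree x p := ⟨j, hj⟩
        rw [Finset.sum_eq_single j]
        · rw [← Finset.prod_mul_distrib]
          refine Finset.prod_congr rfl fun v _ => ?_
          have hflag : xor true (decide (Agree x p)) = false := by simp [hp']
          rw [if_pos (hj v), if_pos hflag]
        · intro k _ hk
          refine Finset.prod_eq_zero (Finset.mem_univ v₀) (if_neg fun h => hk ?_)
          rw [← h hv₀, hj v₀ hv₀]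
        · simp
      · have hflag : ¬ xor true (decide (Agree x p)) = false := by simp [hp]
        have hz : (∏ v : Fin n, if xor true (decide (Agree x p)) = false then P.1 (p v) 0 else 0) =
            0 := Finset.prod_eq_zero (Finset.mem_univ v₀) (if_neg hflag)
        rw [hz, mul_zero]
        symm
        refine Finset.sum_eq_zero fun j _ => ?_
        obtain ⟨v, hv⟩ : ∃ v, ¬ (x v = true → p v = j) := by
          by_contra! h
          exact hp ⟨j, h⟩
        exact Finset.prod_eq_zero (Finset.mem_univ v) (if_neg hv)
    refine (Finset.sum_congr rfl fun p _ => h1 p).trans ?_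
    rw [Finset.sum_comm]
    -- The `m` parties in `x` give equal factors, and the others a factor independent of `j`, which
    -- can be pulled out of the sum over `j`.
    have h2 : ∀ j, (∑ p : Fin n → Fin 3, ∏ v, if x v = true → p v = j then g v (p v) else 0) =
        (U.1 i j * P.1 j 0) ^ m *
          ∏ v ∈ Finset.univ.filter (fun v => ¬ x v = true), ∑ k, g v k := by
      intro j
      have h3 := Finset.prod_univ_sum (fun _ : Fin n => (Finset.univ : Finset (Fin 3)))
        fun v k => if x v = true → k = j then g v k else 0
      rw [Fintype.piFinset_univ] at h3
      rw [← h3, ← Finset.prod_filter_mul_prod_filter_not _ (fun v => x v = true)]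
      congr 1
      · rw [← hx, ← Finset.prod_const]
        refine Finset.prod_congr rfl fun v hv => ?_
        have hv' : x v = true := by simpa using hv
        simp [hv', g, hi v hv']
      · refine Finset.prod_congr rfl fun v hv => ?_
        have hv' : ¬ x v = true := by simpa using hv
        simp [hv']
    simp only [h2, ← Finset.sum_mul, hPU, zero_mul]
  · push Not at hs
    obtain ⟨w, hw⟩ := hs
    have hw : (b w).2 = false := by simpa using hw
    refine Finset.sum_eq_zero fun p _ => ?_
    by_contra hne
    have hP := Finset.prod_ne_zero_iff.1 (right_ne_zero_of_mul hne)
    have hU := Finset.prod_ne_zero_iff.1 (left_ne_zero_of_mul hne)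
    have hflag : ∀ v, xor (b v).2 (decide (Agree x p)) = false := by
      intro v
      by_contra h
      exact hP v (Finset.mem_univ v) (if_neg h)
    have hp : ¬ Agree x p := by simpa [hw] using hflag w
    have hs : ∀ v, (b v).2 = false := by
      intro v
      simpa [hp] using hflag v
    refine hp ?_
    have hpb : p = fun v => (b v).1 := by
      funext v
      by_contra h
      refine hU v (Finset.mem_univ v) ?_
      simp only [hs]
      exact Matrix.one_apply_ne (Ne.symm h)
    rw [hpb]
    exact hb

end Desynchronization

namespace Algorithm

/-! ### The tests for all guesses combined into a computation of `H 1`. -/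

section WeightOne

open Matrix

set_option synthInstance.maxSize 2000

/-- Data registers: for each guess of the weight a value and a flag. -/
abbrev TestData (N : ℕ) : Type := Fin (N + 1) → Fin 3 × Bool

/-- Indices of the queries: a guess of the weight, and a value. -/
abbrev TestIndex (N : ℕ) : Type := Fin (N + 1) × Fin 3

/-- Initial content of the data registers. -/
def testStart (N : ℕ) : TestData N := fun _ => (0, false)

/-- The query whether no party with input `1` holds another value. -/
def testQuery {N : ℕ} (t : TestIndex N) (x : Bool) (χ : TestData N) : Bool :=
  x && !decide ((χ t.1).1 = t.2)

/-- Adds to each flag whether the values agree. -/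
def flagAnswer {N : ℕ} (h : TestIndex N → Bool) (p : Bool × TestData N) : Bool × TestData N :=
  (p.1, fun m => ((p.2 m).1, xor (p.2 m).2 (decide (∃ i, h (m, i) = true))))

/-- Clears the output unless for each guess exactly one value is held. -/
def outputAnswer {N : ℕ} (h : TestIndex N → Bool) (p : Bool × TestData N) : Bool × TestData N :=
  open Classical in (xor p.1 (!decide (∀ m, ∃! i, h (m, i) = true)), p.2)

theorem flagAnswer_involutive {N : ℕ} (h : TestIndex N → Bool) :
    Function.Involutive (flagAnswer h) :=
  fun p => Prod.ext rfl (funext fun m => Prod.ext rfl (by simp [flagAnswer]))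

theorem outputAnswer_involutive {N : ℕ} (h : TestIndex N → Bool) :
    Function.Involutive (outputAnswer h) :=
  fun p => Prod.ext (by simp [outputAnswer]) rfl

theorem testQuery_flagAnswer {N : ℕ} (t : TestIndex N) (x : Bool) (h : TestIndex N → Bool)
    (p : Bool × TestData N) : testQuery t x (flagAnswer h p).2 = testQuery t x p.2 := rfl

theorem testQuery_outputAnswer {N : ℕ} (t : TestIndex N) (x : Bool) (h : TestIndex N → Bool)
    (p : Bool × TestData N) : testQuery t x (outputAnswer h p).2 = testQuery t x p.2 := rfl

theorem H_zero_eq_true {n : ℕ} (z : Fin n → Bool) : H 0 z = true ↔ ∀ v, z v = false := by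
  simp [H, Finset.filter_eq_empty_iff]

theorem H_zero_query {N n : ℕ} (m : Fin (N + 1)) (i : Fin 3) (x : Fin n → Bool)
    (χ : Fin n → TestData N) :
    H 0 (query testQuery (m, i) x χ) = true ↔ ∀ v, x v = true → (χ v m).1 = i := by
  rw [H_zero_eq_true]
  refine forall_congr' fun v => ?_
  simp [query, testQuery]

variable {N n : ℕ}

/-- Amplitudes that factorize into the contributions of the tests. -/
def testState (F : (Fin n → Bool) → (Fin n → Bool) → ℂ)
    (φ : Fin (N + 1) → (Fin n → Bool) → (Fin n → Fin 3 × Bool) → ℂ) :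
    (Fin n → Bool) → (Fin n → Bool) → (Fin n → TestData N) → ℂ :=
  fun x y χ => F x y * ∏ m, φ m x fun v => χ v m

theorem piMat_testState (K : Fin (N + 1) → unitaryGroup (Fin 3 × Bool) ℂ)
    (F : (Fin n → Bool) → (Fin n → Bool) → ℂ)
    (φ : Fin (N + 1) → (Fin n → Bool) → (Fin n → Fin 3 × Bool) → ℂ) :
    (fun x y => piMat (fun _ => (piUnitary K).1) *ᵥ testState F φ x y) =
      testState F fun m x => piMat (fun _ => (K m).1) *ᵥ φ m x := by
  funext x y
  have h := piMat_swap_mulVec (fun (_ : Fin n) m => (K m).1) fun m => φ m x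
  have h2 : testState F φ x y = F x y • fun χ : Fin n → TestData N =>
    ∏ m, φ m x fun v => χ v m := rfl
  rw [h2, mulVec_smul]
  exact congrArg (F x y • ·) h

theorem answered_flagAnswer (F : (Fin n → Bool) → (Fin n → Bool) → ℂ)
    (φ : Fin (N + 1) → (Fin n → Bool) → (Fin n → Fin 3 × Bool) → ℂ) :
    answered testQuery (testState F φ) flagAnswer (H 0) =
      testState F fun m x b => φ m x (flagged x b) := by
  funext x y χ
  simp only [answered, testState, flagAnswer, H_zero_query]
  refine congrArg (F x y * ·) (Finset.prod_congr rfl fun m _ => congrArg (φ m x) ?_)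
  funext v
  refine Prod.ext rfl (congrArg (xor (χ v m).2) ?_)
  exact decide_eq_decide.2 Iff.rfl

/-- Amplitudes of input and output registers with value `f` in all output registers. -/
def labelled (α : (Fin n → Bool) → ℂ) (f : (Fin n → Bool) → Bool) (x y : Fin n → Bool) : ℂ :=
  if ∀ v, y v = f x then α x else 0

/-- The new output depends on `x` alone wherever the tests have nonzero amplitude, so the amplitudes
still factorize and the tests can be undone. -/
theorem answered_outputAnswer (α : (Fin n → Bool) → ℂ)
    (φ : Fin (N + 1) → (Fin n → Bool) → (Fin n → Fin 3 × Bool) → ℂ) (hN : n ≤ N)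
    (hφ : ∀ (m : Fin (N + 1)) x b, 2 ≤ (m : ℕ) →
      (Finset.univ.filter fun v => x v = true).card = m → (Agree x fun v => (b v).1) →
      φ m x b = 0) :
    answered testQuery (testState (labelled α fun _ => true) φ) outputAnswer (H 0) =
      testState (labelled α (H 1)) φ := by
  classical
  funext x y χ
  simp only [answered, testState, outputAnswer, H_zero_query]
  by_cases h0 : (∏ m, φ m x fun v => χ v m) = 0
  · rw [h0, mul_zero, mul_zero]
  congr 1
  have hJ : (decide (∀ m, ∃! i, ∀ v, x v = true → (χ v m).1 = i)) = H 1 x := by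
    rw [H, decide_eq_decide]
    constructor
    · intro h
      by_contra hne
      rcases Nat.lt_or_gt_of_ne hne with hlt | hgt
      -- With weight zero every value is held vacuously; uniqueness in `∃!` is what rules this case
      -- out.
      · have hx : ∀ v, ¬ x v = true := by
          have := Finset.card_eq_zero.1 (Nat.lt_one_iff.1 hlt)
          simpa [Finset.filter_eq_empty_iff] using this
        have := (h 0).unique (y₁ := 0) (y₂ := 1) (fun v hv => absurd hv (hx v))
          fun v hv => absurd hv (hx v)
        exact absurd this (by decide)
      -- The true weight is among the guesses since `n ≤ N`; agreement in its test would have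
      -- amplitude zero.
      · have hk : (Finset.univ.filter fun v => x v = true).card < N + 1 := by
          have := Finset.card_le_univ (Finset.univ.filter fun v => x v = true)
          rw [Fintype.card_fin] at this
          omega
        have := Finset.prod_ne_zero_iff.1 h0 ⟨_, hk⟩ (Finset.mem_univ _)
        exact this (hφ ⟨_, hk⟩ x _ hgt rfl (h _).exists)
    · intro h m
      obtain ⟨v, hv⟩ := Finset.card_eq_one.1 h
      have hxv : ∀ w, x w = true ↔ w = v := fun w => by
        have := Finset.ext_iff.1 hv w
        simpa using this
      refine ⟨(χ v m).1, fun w hw => by rw [(hxv w).1 hw], fun i hi => (hi v ((hxv v).2 rfl)).symm⟩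
  have : ∀ v, (xor (y v) (!decide (∀ m, ∃! i, ∀ v, x v = true → (χ v m).1 = i)) = true) ↔
      y v = H 1 x := by
    intro v
    rw [hJ]
    generalize y v = a, H 1 x = b
    revert a b
    decide
  simp only [labelled, this]

variable (A : Algorithm) {W : Network n}

theorem distributed_cleanAnc_host (α : (Fin n → Bool) → ℂ) (f : (Fin n → Bool) → Bool) :
    (A.host TestData TestIndex testStart).distributed N W α f
        (fun _ => (A.host TestData TestIndex testStart).cleanAnc N W) =
      joint testQuery (testState (labelled α f) fun _ _ => blank)
        fun _ => A.basisInit N W fun _ => false := by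
  classical
  funext c
  have hblank : (∏ m : Fin (N + 1), blank fun v => dat c v m) =
      if ∀ v, dat c v = testStart N then 1 else 0 := by
    simp only [blank, Finset.prod_ite_zero, Finset.prod_const_one, Finset.mem_univ, true_imp_iff]
    congr 1
    rw [forall_comm]
    simp only [testStart, funext_iff]
  have hinst : ∀ κ : A.GConf N W, A.basisInit N W (fun _ => false) κ =
      if ∀ v, κ v = (false, true, A.start N (W.deg v), fun _ => Word.empty _) then 1 else 0 := by
    intro κ
    simp only [basisInit, initState, distributed, cleanAnc, Pi.single_apply, ← ite_and, mul_ite,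
      mul_one, mul_zero]
    refine if_congr ?_ rfl rfl
    simp only [funext_iff, inputs, anc, initAnc, ← forall_and]
    refine forall_congr' fun v => ?_
    constructor
    · rintro ⟨h1, h2, h3⟩
      exact Prod.ext h3 (Prod.ext h1 h2)
    · intro h
      rw [h]
      exact ⟨rfl, rfl, rfl⟩
  simp only [joint, testState, hblank, hinst, labelled, distributed, cleanAnc]
  simp only [Finset.prod_ite_zero, Finset.prod_const_one, Finset.mem_univ, true_imp_iff, mul_ite,
    mul_one, mul_zero, ← ite_and]
  refine if_congr ?_ rfl rfl
  constructor
  · rintro ⟨hy, hc⟩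
    have hv : ∀ v, (c v).2.2 = (A.host TestData TestIndex testStart).initAnc N W v := congrFun hc
    refine ⟨fun v i => ?_, fun t v => ?_, fun v => ?_, hy⟩
    · exact congrArg (fun a => a.2 i) (hv v)
    · exact congrArg (fun a => a.1.2 t) (hv v)
    · exact congrArg (fun a => a.1.1) (hv v)
  · rintro ⟨hs, hκ, hχ, hy⟩
    exact ⟨hy, funext fun v =>
      Prod.ext (Prod.ext (hχ v) (funext fun t => hκ t v)) (funext fun i => hs v i)⟩

/-- The circuit that computes whether the weight is one. -/
def weightOneCircuit (P U : ℕ → unitaryGroup (Fin 3) ℂ) (N : ℕ) :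
    (A.host TestData TestIndex testStart).Circuit N :=
  [some (A.dataLocal TestData TestIndex testStart N (piUnitary fun m => prepare (P m)))] ++
  (A.block testStart testQuery flagAnswer_involutive ++
  ([some (A.dataLocal TestData TestIndex testStart N (piUnitary fun m => desync (U m)))] ++
  (A.block testStart testQuery outputAnswer_involutive ++
  ([some (A.dataLocal TestData TestIndex testStart N (piUnitary fun m => (desync (U m))⁻¹))] ++
  (A.block testStart testQuery flagAnswer_involutive ++
  [some (A.dataLocal TestData TestIndex testStart N (piUnitary fun m => (prepare (P m))⁻¹))])))))

theorem exchanges_weightOneCircuit (P U : ℕ → unitaryGroup (Fin 3) ℂ) (N : ℕ) :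
    exchanges (A.weightOneCircuit P U N) = 6 * A.rounds N := by
  simp only [weightOneCircuit, exchanges_append, exchanges_block, exchanges_some]
  omega

variable {P U : ℕ → unitaryGroup (Fin 3) ℂ} (α : (Fin n → Bool) → ℂ)

/-- The amplitudes of the tests, in the course of the circuit. -/
def stage (N n : ℕ) (P U : ℕ → unitaryGroup (Fin 3) ℂ) :
    Fin 4 → Fin (N + 1) → (Fin n → Bool) → (Fin n → Fin 3 × Bool) → ℂ
  | 0 => fun _ _ => blank
  | 1 => fun m _ => piMat (fun _ => (prepare (P m)).1) *ᵥ blank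
  | 2 => fun m x b => (piMat (fun _ => (prepare (P m)).1) *ᵥ blank) (flagged x b)
  | 3 => fun m x => piMat (fun _ => (desync (U m)).1) *ᵥ fun b =>
      (piMat (fun _ => (prepare (P m)).1) *ᵥ blank) (flagged x b)

variable (f : (Fin n → Bool) → Bool)

/-- The states in the course of the circuit. -/
abbrev stageState (N : ℕ) (W : Network n) (P U : ℕ → unitaryGroup (Fin 3) ℂ) (α : (Fin n → Bool) → ℂ)
    (f : (Fin n → Bool) → Bool) (k : Fin 4) :
    (A.host TestData TestIndex testStart).State N W :=
  joint testQuery (testState (labelled α f) (stage N n P U k)) fun _ => A.basisInit N W fun _ => false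

theorem run_dataLocal_stage (K : Fin (N + 1) → unitaryGroup (Fin 3 × Bool) ℂ) (k k' : Fin 4)
    (h : ∀ m x, piMat (fun _ => (K m).1) *ᵥ stage N n P U k m x = stage N n P U k' m x) :
    run [some (A.dataLocal TestData TestIndex testStart N (piUnitary K))]
      (A.stageState N W P U α f k) = A.stageState N W P U α f k' := by
  rw [run_some, applyLocal_dataLocal, piMat_testState]
  simp only [h]

theorem run_flag_stage (hA : A.ExactlyComputes N W (H 0)) (k k' : Fin 4)
    (h : ∀ m (x : Fin n → Bool) b, stage N n P U k m x (flagged x b) = stage N n P U k' m x b) :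
    run (A.block testStart testQuery flagAnswer_involutive) (A.stageState N W P U α f k) =
      A.stageState N W P U α f k' := by
  rw [run_block _ _ _ testQuery_flagAnswer hA, answered_flagAnswer]
  simp only [h]

theorem run_output_stage (hA : A.ExactlyComputes N W (H 0)) (hN : n ≤ N)
    (hPU : ∀ m : ℕ, 2 ≤ m → ∀ i, ∑ j, ((U m).1 i j * (P m).1 j 0) ^ m = 0) :
    run (A.block testStart testQuery outputAnswer_involutive)
      (A.stageState N W P U α (fun _ => true) 3) = A.stageState N W P U α (H 1) 3 := by
  rw [run_block _ _ _ testQuery_outputAnswer hA, answered_outputAnswer α _ hN]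
  intro m x b hm hx hb
  exact desync_flagged_prepare_blank (by omega) (hPU m hm) hx hb

/-- Only the output block changes the label; the stages are passed up to `3` and back to `0`. The
constant `18` is three blocks at `6` each. -/
theorem run_weightOneCircuit (hA : A.ExactlyComputes N W (H 0)) (hN : n ≤ N)
    (hPU : ∀ m : ℕ, 2 ≤ m → ∀ i, ∑ j, ((U m).1 i j * (P m).1 j 0) ^ m = 0) :
    run (A.weightOneCircuit P U N) (A.stageState N W P U α (fun _ => true) 0) =
        A.stageState N W P U α (H 1) 0 ∧
      cost (A.weightOneCircuit P U N) (A.stageState N W P U α (fun _ => true) 0) ≤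
        18 * (Fintype.card (TestIndex N) : ℕ∞) * A.bitComplexity N W := by
  have h1 := A.run_dataLocal_stage (N := N) (W := W) (P := P) (U := U) α (fun _ => true)
    (fun m => prepare (P m)) 0 1 fun _ _ => rfl
  have h2 := A.run_flag_stage (P := P) (U := U) α (fun _ => true) hA 1 2 fun _ _ _ => rfl
  have h3 := A.run_dataLocal_stage (N := N) (W := W) (P := P) (U := U) α (fun _ => true)
    (fun m => desync (U m)) 2 3 fun _ _ => rfl
  have h4 := A.run_output_stage α hA hN hPU
  have h5 := A.run_dataLocal_stage (N := N) (W := W) (P := P) (U := U) α (H 1)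
    (fun m => (desync (U m))⁻¹) 3 2 fun _ _ => piMat_inv_mulVec_mulVec _ _
  have h6 := A.run_flag_stage (P := P) (U := U) α (H 1) hA 2 1
    fun m x b =>
      congrArg (piMat (fun _ => (prepare (P m)).1) *ᵥ blank) (flagged_involutive x b)
  have h7 := A.run_dataLocal_stage (N := N) (W := W) (P := P) (U := U) α (H 1)
    (fun m => (prepare (P m))⁻¹) 1 0 fun _ _ => piMat_inv_mulVec_mulVec _ _
  constructor
  · simp only [weightOneCircuit, run_append, h1, h2, h3, h4, h5, h6, h7]
  · simp only [weightOneCircuit, cost_append, h1, h2, h3, h4, h5, h6, cost_some, zero_add,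
      add_zero]
    have c1 := cost_block (A := A) (x₀ := testStart) (W := W) testQuery
      (testState (labelled α fun _ => true) (stage N n P U 1)) flagAnswer_involutive
      testQuery_flagAnswer hA
    have c2 := cost_block (A := A) (x₀ := testStart) (W := W) testQuery
      (testState (labelled α fun _ => true) (stage N n P U 3)) outputAnswer_involutive
      testQuery_outputAnswer hA
    have c3 := cost_block (A := A) (x₀ := testStart) (W := W) testQuery
      (testState (labelled α (H 1)) (stage N n P U 2)) flagAnswer_involutive
      testQuery_flagAnswer hA
    refine (add_le_add c1 (add_le_add c2 c3)).trans (le_of_eq ?_)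
    ring

end WeightOne

end Algorithm

end AnonNet

end

theorem theorem4 :
    ∃ C : ℕ, ∀ A : AnonNet.Algorithm, ∃ B : AnonNet.Algorithm,
      ∀ (N n : ℕ) (W : AnonNet.Network n), n ≤ N →
        A.ExactlyComputes N W (AnonNet.H 0) →
          B.CleanlyComputes N W (AnonNet.H 1) ∧
          B.roundComplexity N ≤ C * A.roundComplexity N ∧
          B.bitComplexity N W ≤ (C : ℕ∞) * (N : ℕ∞) * A.bitComplexity N W := by
  have hex : ∀ m : ℕ, ∃ P U : Matrix.unitaryGroup (Fin 3) ℂ,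
      2 ≤ m → ∀ i, ∑ j, (U.1 i j * P.1 j 0) ^ m = 0 := by
    intro m
    by_cases hm : 2 ≤ m
    · obtain ⟨P, U, h⟩ := AnonNet.exists_desynchronizing hm
      exact ⟨P, U, fun _ => h⟩
    -- Guesses below two need no desynchronization, so any matrices will do.
    · exact ⟨1, 1, fun h => absurd h hm⟩
  choose P U hPU using hex
  -- There are `3 * (N + 1)` queries, and `18 * 3 * (N + 1) ≤ 108 * N` because `1 ≤ n ≤ N`; for the
  -- rounds `6` would suffice.
  refine ⟨108, fun A => ⟨AnonNet.Algorithm.withCircuit _ (A.weightOneCircuit P U),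
    fun N n W hN hA => ?_⟩⟩
  have hrun := fun α => A.run_weightOneCircuit (W := W) α hA hN hPU
  have hinit : ∀ α, (A.host AnonNet.Algorithm.TestData AnonNet.Algorithm.TestIndex
      AnonNet.Algorithm.testStart).initState N W α =
        A.stageState N W P U α (fun _ => true) 0 :=
    fun α => A.distributed_cleanAnc_host α _
  refine ⟨fun α => ?_, ?_, iSup_le fun α => ?_⟩
  · rw [AnonNet.Algorithm.finalState_withCircuit, hinit, (hrun α.1).1]
    exact (A.distributed_cleanAnc_host α.1 _).symm
  · change AnonNet.Algorithm.exchanges _ ≤ _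
    rw [A.exchanges_weightOneCircuit]
    exact Nat.mul_le_mul_right _ (by norm_num)
  · rw [AnonNet.Algorithm.sum_bitsSent_withCircuit, hinit]
    refine (hrun α.1).2.trans (mul_le_mul_left ?_ _)
    have hn : 1 ≤ n := by
      obtain ⟨v⟩ := W.connected.nonempty
      exact v.pos
    have hcard : Fintype.card (AnonNet.Algorithm.TestIndex N) = (N + 1) * 3 := by simp
    rw [hcard]
    have : 18 * ((N + 1) * 3) ≤ 108 * N := by omega
    exact_mod_cast this
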